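/- **Setting.** Consider a perfect-information two-player zero-sum stochastic mean-payoff game: a finite state set $S$, nonempty finite action sets $A_i$ ($i\in S$) and $B_{i,a}$ ($a\in A_i$), and probability vectors $P_i^{ab}\in\Delta(S)$ for $(i,a,b)\in E:=\{(i,a,b): i\in S, a\in A_i, b\in B_{i,a}\}$ (the rewards play no role). A pair of policies $\sigma:i\mapsto\sigma(i)\in A_i$, $\tau:(i,a)\mapsto\tau(i,a)\in B_{i,a}$ induces the Markov matrix $P^{\sigma\tau}$ with rows $P_i^{\sigma(i)\,\tau(i,\sigma(i))}$. For $c\in S$ let $\mathcal T_{ic}$ be the maximum over $(\sigma,\tau)$ of the expected value of $\inf\{k\ge1: X_k=c\}$ for the chain $X$ with matrix $P^{\sigma\tau}$ and $X_0=i$. Let $P_{(c)i}^{ab}$ be $P_i^{ab}$ with its $c$-th entry replaced by $0$. Assume that $c\in S$ and a real number $H$ are given with $\mathcal T_{ic}\le H$ for all $i\in S$ (so $H\ge1$), and put $\lambda:=1-1/H\in[0,1)$. **Algorithms.** Let a structured game be given by sub-Markovian vectors $P_i^{ab}$, discount factors $\gamma_i^{ab}\ge0$, a linear map $L$ of $\mathbb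 R^S$ and affine functions $G_i^{ab}$, with operator $T_i(w)=\min_a\max_b\{\gamma_i^{ab}P_i^{ab}Lw+G_i^{ab}(w)\}$. Each $P_i^{ab}$ is completed to a probability law on $S\cup\{0\}$. - $\mathtt{ApxTransC}(u,M,i,a,b,\epsilon,\delta)$ returns the mean of $u_j$ (with $u_0=0$) over $m=\lceil 2M^2\epsilon^{-2}\ln(2/\delta)\rceil$ independent samples $j$ of the law associated with $P_i^{ab}$. - $\mathtt{SApxVal}(w,w_0,x,\epsilon,\delta)$ sets $u=L(w-w_0)$, $M=\|L\|_\infty\|w-w_0\|_\infty$ and returns $\tilde w_i=\min_a\max_b\{\gamma_i^{ab}(x_i^{ab}+\mathtt{ApxTransC}(u,M,i,a,b,\epsilon,\delta/|E|))+G_i^{ab}(w)\}$ and minimizing and maximizing policies. - $\mathtt{SSampledRandVI}(w_0,J,\epsilon,\delta)$ samples the offsets $\tilde x_i^{ab}=\mathtt{ApxTransC}(Lw_0,\|L\|_\infty\|w_0\|_\infty,i,a,b,\epsilon,\frac{\delta}{2|E|})$ and then computes $w_j$ as the vector returned by $\mathtt{SApxVal}(w_{j-1},w_0,\tilde x,\epsilon,\frac{\delta}{2J})$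 for $j=1,\dots,J$; it returns $w_J$ and the last policies. - The sampled-offset algorithm $\mathtt{SSublinearRandVI}(\epsilon,\delta,\lambda,W,\Gamma,d_1,d_2)$ sets $K=\lceil\log_2(d_2W/\epsilon)\rceil$, $J=\lceil\frac{\ln 4}{1-\lambda}\rceil$, $w_0=0$, computes $w_k$ as the vector returned by $\mathtt{SSampledRandVI}(w_{k-1},J,\frac{1-\lambda}{4d_1\Gamma}\frac{W}{2^k},\frac{\delta}{K})$ for $k=1,\dots,K$, and returns $w_K$ and the last policies. Running time is the number of steps of a real RAM on which an arithmetic operation, a logarithm, a rounding, a comparison, a memory access, drawing one sample from the law associated with some $P_i^{ab}$, and each evaluation of some $G_i^{ab}$ take one step, and applying $L$ takes $|S|$ steps. **Theorem.** There are absolute constants $C$ and $k$ such that the following holds for all games, $c$, $H$, $\lambda$ as above and all $\delta\in(0,1)$. Call $\mathtt{SSublinearRandVI}(\tfrac14,\delta,\lambda,1,1,1,\tfrac1{1-\lambda})$ for the structured game on the state set $S$ with operator $w\mapsto\big(1+\max_{a,b}P_{(c)i}^{ab}w\big)_{i\in S}$ (MIN has one action, MAX chooses the pair $(a,b)$, $\gamma=1$,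 $L=\mathrm{Id}$, $G=1$), and let $\varphi$ be twice the vector that it returns. Then with probability at least $1-\delta$ all of the following hold: 1. $\varphi\ge0$ and $\varphi_i\ge 1+\max_{a,b}P_{(c)i}^{ab}\varphi$ for all $i\in S$; 2. $|\varphi_i-2\mathcal T_{ic}|\le\frac12$ for all $i\in S$, and $\lambda_\varphi:=1-1/\|\varphi\|_\infty$ satisfies $\frac1{1-\lambda_\varphi}\le\frac2{1-\lambda}+\frac12$; 3. the running time of the whole computation is $\tilde O\big(\frac{|E|}{(1-\lambda)^6}\log\frac1\delta\big)$, in the sense that it is at most $C\,F\,(1+\ln F)^k$ with $F=\frac{|E|}{(1-\lambda)^6}\max(1,\ln\frac1\delta)\ge1$. -/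

import Mathlib

open scoped ENNReal
open MeasureTheory ProbabilityTheory

/-! ### Randomized computations with a step count -/

/-- A randomized computation with result in `α`, given by the joint law of the pair
(number of elementary steps performed, result). -/
def RandComp (α : Type) : Type := PMF (ℕ × α)

namespace RandComp

/-- Sequential composition: the step counts add up. -/
noncomputable instance : Monad RandComp where
  pure a := PMF.pure (0, a)
  bind m f := PMF.bind m fun p => PMF.map (fun q => (p.1 + q.1, q.2)) (f p.2)

/-- A deterministic subroutine with result `x` that takes `t` steps. -/
noncomputable def charge {α : Type} (t : ℕ) (x : α) : RandComp α := PMF.pure (t, x)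

/-- One elementary step of a real RAM: an arithmetic operation, a logarithm, a rounding,
a comparison, or a read or write in memory. -/
noncomputable def op {α : Type} (x : α) : RandComp α := charge 1 x

/-- One step drawing a fresh sample from the law `p`. -/
noncomputable def draw {α : Type} (p : PMF α) : RandComp α := PMF.map (fun x => (1, x)) p

/-- `for i in l do s := body i s`, starting from `s = init`.  The management of the loop costs
one step per round, in addition to the cost of the body. -/
noncomputable def loop {ι α : Type} (l : List ι) (init : α) (body : ι → α → RandComp α) :
    RandComp α :=
  match l with
  | [] => pure init
  | i :: l => do
      let s ← body i init
      let s ← op s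
      loop l s body

/-- The probability that the pair (number of steps, result) of a run belongs to `s`. -/
noncomputable def prob {α : Type} (m : RandComp α) (s : Set (ℕ × α)) : ℝ≥0∞ :=
  PMF.toOuterMeasure m s

end RandComp

/-- The list of all elements of a finite type, over which the loops run. -/
noncomputable def elems (ι : Type) [Fintype ι] : List ι := (Finset.univ : Finset ι).toList

/-! ### Structured stochastic games and the sampled-offset algorithm -/

/-- The set of admissible triples (state, action of MIN, action of MAX). -/
abbrev Triples (S : Type) (A : S → Type) (B : ∀ i, A i → Type) : Type :=
  Σ i : S, Σ a : A i, B i a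

/-- A perfect information zero-sum game with sub-Markovian transitions `P`, discount factors `γ`,
and Shapley operator `w ↦ min_a max_b (γ i a b * (P i a b ⬝ L w) + G i a b w)`. -/
structure StructuredGame (S : Type) [Fintype S] (A : S → Type) (B : ∀ i, A i → Type) where
  P : ∀ (i : S) (a : A i), B i a → S → ℝ
  P_nonneg : ∀ i a b j, 0 ≤ P i a b j
  P_sum_le : ∀ i a b, ∑ j, P i a b j ≤ 1
  γ : ∀ (i : S) (a : A i), B i a → ℝ
  γ_nonneg : ∀ i a b, 0 ≤ γ i a b
  L : (S → ℝ) →L[ℝ] (S → ℝ)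
  G : ∀ (i : S) (a : A i), B i a → ((S → ℝ) →ᵃ[ℝ] ℝ)

/-- The probability law on `S ∪ {cemetery}` (the cemetery is `none`) associated with a
nonnegative vector `p` of total mass at most `1`. -/
noncomputable def cemeteryLaw {S : Type} [Fintype S] (p : S → ℝ) (h0 : ∀ j, 0 ≤ p j)
    (h1 : ∑ j, p j ≤ 1) : PMF (Option S) :=
  PMF.ofFintype
    (fun o => match o with
      | none => ENNReal.ofReal (1 - ∑ j, p j)
      | some j => ENNReal.ofReal (p j))
    (by
      rw [Fintype.sum_option, ← ENNReal.ofReal_sum_of_nonneg (fun j _ => h0 j),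
        ← ENNReal.ofReal_add (by linarith) (Finset.sum_nonneg fun j _ => h0 j)]
      simp)

/-- The entry for `b` enters the running maximum `acc` (value and maximizer so far). -/
noncomputable def keepMax {β : Type} (acc : Option (ℝ × β)) (q : ℝ) (b : β) : Option (ℝ × β) :=
  match acc with
  | none => some (q, b)
  | some (q', b') => if q' < q then some (q, b) else some (q', b')

/-- The entry for `b` enters the running minimum `acc` (value and minimizer so far). -/
noncomputable def keepMin {β : Type} (acc : Option (ℝ × β)) (q : ℝ) (b : β) : Option (ℝ × β) :=
  match acc with
  | none => some (q, b)
  | some (q', b') => if q < q' then some (q, b) else some (q', b')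

/-- Computes the sup-norm of a vector. -/
noncomputable def supNorm {S : Type} [Fintype S] (u : S → ℝ) : RandComp ℝ :=
  RandComp.loop (elems S) 0 fun i s => do
    let y ← RandComp.op |u i|
    RandComp.op (max s y)

open Classical in
/-- Computes the difference of two vectors. -/
noncomputable def vecSub {S : Type} [Fintype S] (w w₀ : S → ℝ) : RandComp (S → ℝ) :=
  RandComp.loop (elems S) (fun _ => 0) fun i d => do
    let y ← RandComp.op (w i - w₀ i)
    RandComp.op (Function.update d i y)

namespace StructuredGame

section Algorithms

variable {S : Type} [Fintype S]
  {A : S → Type} [∀ i, Fintype (A i)] [∀ i, Nonempty (A i)]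
  {B : ∀ i, A i → Type} [∀ i a, Fintype (B i a)] [∀ i a, Nonempty (B i a)]

/-- Vector, policy of MIN, policy of MAX. -/
abbrev Output (S : Type) (A : S → Type) (B : ∀ i, A i → Type) : Type :=
  (S → ℝ) × (∀ i, A i) × (∀ i a, B i a)

/-- Approximate transition with cemetery: the empirical mean of `⌈2 M² ε⁻² ln (2 / δ)⌉` samples of
`u`, with `u = 0` at the cemetery. -/
noncomputable def apxTransC (g : StructuredGame S A B) (u : S → ℝ) (M : ℝ) (i : S) (a : A i)
    (b : B i a) (ε δ : ℝ) : RandComp ℝ := do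
  let q ← RandComp.op (2 / δ)
  let l ← RandComp.op (Real.log q)
  let M2 ← RandComp.op (M ^ 2)
  let e2 ← RandComp.op (ε ^ 2)
  let t ← RandComp.op (2 * M2)
  let t ← RandComp.op (t / e2)
  let t ← RandComp.op (t * l)
  let m ← RandComp.op ⌈t⌉₊
  let s ← RandComp.loop (List.range m) (0 : ℝ) fun _ s => do
    let o ← RandComp.draw (cemeteryLaw (g.P i a b) (g.P_nonneg i a b) (g.P_sum_le i a b))
    let y ← RandComp.op (match o with
      | none => 0
      | some j => u j)
    RandComp.op (s + y)
  RandComp.op (s / m)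

open Classical in
/-- Structured approximate value operator, from the offsets `x` (approximations of
`P i a b ⬝ L w₀`).  The vector `L d` is computed in `|S|` steps and the number `G i a b w` in
one step. -/
noncomputable def sApxVal (g : StructuredGame S A B) (w w₀ : S → ℝ) (x : Triples S A B → ℝ)
    (ε δ : ℝ) : RandComp (Output S A B) := do
  let d ← vecSub w w₀
  let nrm ← supNorm d
  let M ← RandComp.op (‖g.L‖ * nrm)
  let u ← RandComp.charge (Fintype.card S) (g.L d)
  let δ' ← RandComp.op (δ / Fintype.card (Triples S A B))
  let init : Output S A B :=
    (fun _ => 0, fun _ => Classical.arbitrary _, fun _ _ => Classical.arbitrary _)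
  RandComp.loop (elems S) init fun i out => do
    let r ← RandComp.loop (elems (A i)) ((none : Option (ℝ × A i)), out.2.2) fun a acc => do
      let best ← RandComp.loop (elems (B i a)) (none : Option (ℝ × B i a)) fun b best => do
        let y ← g.apxTransC u M i a b ε δ'
        let s ← RandComp.op (x ⟨i, a, b⟩ + y)
        let t ← RandComp.op (g.γ i a b * s)
        let z ← RandComp.op (g.G i a b w)
        let q ← RandComp.op (t + z)
        RandComp.op (keepMax best q b)
      let vb := best.getD (0, Classical.arbitrary _)
      let τ ← RandComp.op (Function.update acc.2 i (Function.update (acc.2 i) a vb.2))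
      let best' ← RandComp.op (keepMin acc.1 vb.1 a)
      pure (best', τ)
    let va := r.1.getD (0, Classical.arbitrary _)
    let w' ← RandComp.op (Function.update out.1 i va.1)
    let σ' ← RandComp.op (Function.update out.2.1 i va.2)
    pure (w', σ', r.2)

open Classical in
/-- Structured sampled randomized value iteration: the offsets are sampled once, then `J`
approximate value iterations are performed from `w₀`. -/
noncomputable def sSampledRandVI (g : StructuredGame S A B) (w₀ : S → ℝ) (J : ℕ) (ε δ : ℝ) :
    RandComp (Output S A B) := do
  let nrm ← supNorm w₀
  let M ← RandComp.op (‖g.L‖ * nrm)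
  let u ← RandComp.charge (Fintype.card S) (g.L w₀)
  let h ← RandComp.op (δ / 2)
  let δ₁ ← RandComp.op (h / Fintype.card (Triples S A B))
  let δ₂ ← RandComp.op (h / J)
  let x ← RandComp.loop (elems (Triples S A B)) (fun _ => 0 : Triples S A B → ℝ) fun e x => do
    let y ← g.apxTransC u M e.1 e.2.1 e.2.2 ε δ₁
    RandComp.op (Function.update x e y)
  let init : Output S A B :=
    (w₀, fun _ => Classical.arbitrary _, fun _ _ => Classical.arbitrary _)
  RandComp.loop (List.range J) init fun _ out => g.sApxVal out.1 w₀ x ε δ₂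

/-- Structured sublinear randomized value iteration (the sampled-offset algorithm).  The inputs
`d₁`, `d₂` are the bounds on `‖ψ⁻¹‖` and `‖ψ‖`, where `ψ` is the weight of the sup-norm for which
the Shapley operator contracts at rate `lam`; `W` bounds the weighted norm of the fixed point and
`Γ` bounds the discount factors. -/
noncomputable def sSublinearRandVI (g : StructuredGame S A B) (ε δ lam W Γ d₁ d₂ : ℝ) :
    RandComp (Output S A B) := do
  let t ← RandComp.op (d₂ * W)
  let t ← RandComp.op (t / ε)
  let t ← RandComp.op (Real.logb 2 t)
  let K ← RandComp.op ⌈t⌉₊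
  let r ← RandComp.op (1 - lam)
  let l ← RandComp.op (Real.log 4)
  let t ← RandComp.op (l / r)
  let J ← RandComp.op ⌈t⌉₊
  let D ← RandComp.op (4 * d₁)
  let D ← RandComp.op (D * Γ)
  let D ← RandComp.op (r / D)
  let δ' ← RandComp.op (δ / K)
  let init : Output S A B :=
    (fun _ => 0, fun _ => Classical.arbitrary _, fun _ _ => Classical.arbitrary _)
  let res ← RandComp.loop (List.range K) (W, init) fun _ p => do
    let εk ← RandComp.op (p.1 / 2)
    let acc ← RandComp.op (D * εk)
    let out ← g.sSampledRandVI p.2.1 J acc δ'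
    pure (εk, out)
  pure res.2

end Algorithms

end StructuredGame

/-! ### Mean payoff games and hitting times -/

/-- A perfect information two-player zero-sum stochastic mean payoff game. -/
structure MeanPayoffGame (S : Type) [Fintype S] (A : S → Type) (B : ∀ i, A i → Type) where
  P : ∀ (i : S) (a : A i), B i a → S → ℝ
  P_nonneg : ∀ i a b j, 0 ≤ P i a b j
  P_sum : ∀ i a b, ∑ j, P i a b j = 1
  r : ∀ (i : S) (a : A i), B i a → ℝ

/-- The row `p` of a Markov matrix as a probability law. -/
noncomputable def rowLaw {S : Type} [Fintype S] (p : S → ℝ) (h0 : ∀ j, 0 ≤ p j)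
    (h1 : ∑ j, p j = 1) : PMF S :=
  PMF.ofFintype (fun j => ENNReal.ofReal (p j)) (by
    rw [← ENNReal.ofReal_sum_of_nonneg (fun j _ => h0 j), h1, ENNReal.ofReal_one])

section HittingTime

variable {S : Type} [Fintype S]

/-- The conditional law of `X (m + 1)` given `(X 0, …, X m)` for the Markov chain with transition
law `Q`, on the discrete measurable space `S`. -/
noncomputable def chainKernel (Q : S → PMF S) (m : ℕ) :
    @Kernel (Finset.Iic m → S) S (@MeasurableSpace.pi _ _ fun _ => ⊤) ⊤ :=
  letI : MeasurableSpace S := ⊤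
  haveI : MeasurableSingletonClass S := ⟨fun _ => trivial⟩
  (Kernel.ofFunOfCountable fun s => (Q s).toMeasure).comap
    (fun x : Finset.Iic m → S => x ⟨m, Finset.mem_Iic.2 le_rfl⟩) (measurable_pi_apply _)

theorem chainKernel_isMarkov (Q : S → PMF S) (m : ℕ) :
    @IsMarkovKernel _ _ (@MeasurableSpace.pi _ _ fun _ => ⊤) ⊤ (chainKernel Q m) := by
  let : MeasurableSpace S := ⊤
  have : MeasurableSingletonClass S := ⟨fun _ => trivial⟩
  have : IsMarkovKernel (Kernel.ofFunOfCountable fun s => (Q s).toMeasure) :=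
    ⟨fun s => PMF.toMeasure.isProbabilityMeasure (Q s)⟩
  exact Kernel.IsMarkovKernel.comap _ _

/-- The law on trajectories `ℕ → S` of the Markov chain with transition law `Q` that starts
at `i`. -/
noncomputable def chainLaw (Q : S → PMF S) (i : S) :
    @Measure (ℕ → S) (@MeasurableSpace.pi _ _ fun _ => ⊤) :=
  letI : MeasurableSpace S := ⊤
  haveI := chainKernel_isMarkov Q
  Kernel.traj (X := fun _ => S) (chainKernel Q) 0 (fun _ => i)

/-- `inf {k ≥ 1 | X k = j}`, with value `∞` if `j` is never reached. -/
noncomputable def hittingTime (j : S) (X : ℕ → S) : ℝ≥0∞ :=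
  ⨅ (k : ℕ) (_ : 1 ≤ k ∧ X k = j), (k : ℝ≥0∞)

/-- The expected first hitting time of `j` from `i`. -/
noncomputable def expectedHittingTime (Q : S → PMF S) (i j : S) : ℝ≥0∞ :=
  @lintegral _ (@MeasurableSpace.pi _ _ fun _ => ⊤) (chainLaw Q i) (hittingTime j)

end HittingTime

namespace MeanPayoffGame

section

variable {S : Type} [Fintype S]
  {A : S → Type} [∀ i, Fintype (A i)] [∀ i, Nonempty (A i)]
  {B : ∀ i, A i → Type} [∀ i a, Fintype (B i a)] [∀ i a, Nonempty (B i a)]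

/-- The transition law of the Markov chain induced by the policies `σ` of MIN and `τ` of MAX. -/
noncomputable def policyChain (g : MeanPayoffGame S A B) (σ : ∀ i, A i) (τ : ∀ i a, B i a) :
    S → PMF S := fun i =>
  rowLaw (g.P i (σ i) (τ i (σ i))) (g.P_nonneg _ _ _) (g.P_sum _ _ _)

/-- The maximal expected first hitting time of `c` from `i`, over all pairs of policies. -/
noncomputable def maxHittingTime (g : MeanPayoffGame S A B) (c i : S) : ℝ≥0∞ :=
  ⨆ (σ : ∀ i, A i) (τ : ∀ i a, B i a), expectedHittingTime (g.policyChain σ τ) i c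

open Classical in
/-- The row `(i, a, b)` of the transition matrix, with the column `c` replaced by zero. -/
noncomputable def deflatedP (g : MeanPayoffGame S A B) (c : S) (i : S) (a : A i) (b : B i a)
    (j : S) : ℝ :=
  if j = c then 0 else g.P i a b j

/-- The structured game with operator `w ↦ 1 + max_{a,b} P_(c) w`: MIN has a single action,
MAX chooses the pair `(a, b)`, the transitions are the deflated ones, `γ = 1`, `L` is the identity
and `G = 1`. -/
noncomputable def hittingGame (g : MeanPayoffGame S A B) (c : S) :
    StructuredGame S (fun _ => Unit) (fun i _ => Σ a : A i, B i a) where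
  P i _ p := g.deflatedP c i p.1 p.2
  P_nonneg i _ p j := by
    unfold deflatedP
    split_ifs
    · exact le_rfl
    · exact g.P_nonneg _ _ _ _
  P_sum_le i _ p := by
    rw [← g.P_sum i p.1 p.2]
    refine Finset.sum_le_sum fun j _ => ?_
    unfold deflatedP
    split_ifs
    · exact g.P_nonneg _ _ _ _
    · exact le_rfl
  γ _ _ _ := 1
  γ_nonneg _ _ _ := zero_le_one
  L := ContinuousLinearMap.id ℝ (S → ℝ)
  G _ _ _ := AffineMap.const ℝ (S → ℝ) 1

instance nonempty_pairs (i : S) : Nonempty (Σ a : A i, B i a) :=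
  ⟨⟨Classical.arbitrary _, Classical.arbitrary _⟩⟩

open Classical in
/-- The computation of the vector `φ`: the sampled-offset algorithm is called on
`w = 1 + max_{a,b} P_(c) w` with accuracy `1 / 4`, failure probability `δ`, contraction rate `lam`,
`W = 1`, `Γ = 1` and the bounds `1` and `1 / (1 - lam)`, and its result is doubled. -/
noncomputable def findPhi (g : MeanPayoffGame S A B) (c : S) (lam δ : ℝ) : RandComp (S → ℝ) := do
  let r ← RandComp.op (1 - lam)
  let d₂ ← RandComp.op (1 / r)
  let out ← (g.hittingGame c).sSublinearRandVI (1 / 4) δ lam 1 1 1 d₂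
  RandComp.loop (elems S) (fun _ => 0) fun i φ => do
    let y ← RandComp.op (2 * out.1 i)
    RandComp.op (Function.update φ i y)

end

end MeanPayoffGame

/-! Write t for the vector of maximal hitting times. It solves t = 1 + max_b P_b t, where P_b are
the deflated rows, and 1 ≤ t ≤ H. Hence P_b t ≤ t - 1 ≤ (1 - 1/H) t for every action, so the
operator w ↦ 1 + max_b P_b w contracts at rate 1 - 1/H in the sup-norm weighted by its own fixed
point (`IsApxValue.abs_sub_le`). The equation itself comes from policy improvement
(`maxHittingTime_optimality`), based on first step analysis and a minimum principle.

A phase of the algorithm turns a weighted error 2R into R. The offsets P_b w₀ are sampled once, and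
then about H ln 4 value iterations sample only P_b (w - w₀). Each iteration has sampling error at
most 2ε with ε = R/(4H), so the weighted error follows r ↦ (1 - 1/H) r + 2ε, whose fixed point is
R/2. The iterates stay within 4RH of w₀, so by Hoeffding an inner estimate costs of order H⁴ samples
up to a logarithm, whatever R is. Offsets cost H⁴/R², and R ≥ 1/(8H) in all phases: this is the
origin of H⁶, while the value iterations contribute only H⁵. After ⌈log₂(4H)⌉ phases the absolute
error is at most 1/4 (`spec_sSublinearRandVI`).

Doubling an approximation with error 1/4 doubles the unit cost in the equation for t. The extra unit
pays for the error 1/2 on both sides of the inequality φ ≥ 1 + max P φ.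

Time and failure are handled together by `RandComp.Spec`, in which step bounds and failure
probabilities add under composition. -/

/-! ### A calculus of running time and failure probability -/

namespace RandComp

variable {α β ι : Type}

/-- The joint law of the number of steps and the result. -/
noncomputable def law (m : RandComp α) : PMF (ℕ × α) := m

theorem law_pure (a : α) : (pure a : RandComp α).law = PMF.pure (0, a) := rfl

theorem law_charge (t : ℕ) (a : α) : (charge t a).law = PMF.pure (t, a) := rfl

theorem law_op (a : α) : (op a).law = PMF.pure (1, a) := rfl

theorem law_draw (p : PMF α) : (draw p).law = PMF.map (fun x => (1, x)) p := rfl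

theorem law_bind (m : RandComp α) (f : α → RandComp β) :
    (m >>= f).law = m.law.bind fun p => PMF.map (fun q => (p.1 + q.1, q.2)) (f p.2).law := rfl

theorem prob_def (m : RandComp α) (s : Set (ℕ × α)) : m.prob s = m.law.toOuterMeasure s := rfl

theorem prob_eq_tsum (m : RandComp α) (s : Set (ℕ × α)) :
    m.prob s = ∑' x, s.indicator m.law x := by
  rw [prob_def, PMF.toOuterMeasure_apply]

theorem prob_bind (m : RandComp α) (f : α → RandComp β) (s : Set (ℕ × β)) :
    (m >>= f).prob s = ∑' p : ℕ × α, m.law p * (f p.2).prob {q | (p.1 + q.1, q.2) ∈ s} := by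
  rw [prob_def, law_bind, PMF.toOuterMeasure_bind_apply]
  refine tsum_congr fun p => ?_
  rw [PMF.toOuterMeasure_map_apply]
  rfl

theorem prob_mono (m : RandComp α) {s t : Set (ℕ × α)} (h : s ⊆ t) : m.prob s ≤ m.prob t :=
  measure_mono h

theorem prob_le_one (m : RandComp α) (s : Set (ℕ × α)) : m.prob s ≤ 1 := by
  rw [prob_eq_tsum]
  calc _ ≤ ∑' x, m.law x := ENNReal.tsum_le_tsum fun x => Set.indicator_le_self _ _ _
    _ = 1 := PMF.tsum_coe _

theorem prob_compl (m : RandComp α) (s : Set (ℕ × α)) : m.prob s + m.prob sᶜ = 1 := by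
  rw [prob_eq_tsum, prob_eq_tsum, ← ENNReal.tsum_add]
  calc _ = ∑' x, m.law x := by
        refine tsum_congr fun x => ?_
        exact congrFun (Set.indicator_self_add_compl s _) x
    _ = 1 := PMF.tsum_coe _

/-- Except with probability at most `η`, the computation `m` takes at most `T` steps and its result
satisfies `Q`. -/
def Spec (m : RandComp α) (T η : ℝ) (Q : α → Prop) : Prop :=
  m.prob {x | ¬((x.1 : ℝ) ≤ T ∧ Q x.2)} ≤ ENNReal.ofReal η

theorem Spec.mono {m : RandComp α} {T T' η η' : ℝ} {Q Q' : α → Prop} (h : m.Spec T η Q)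
    (hT : T ≤ T') (hη : η ≤ η') (hQ : ∀ a, Q a → Q' a) : m.Spec T' η' Q' := by
  refine le_trans (m.prob_mono ?_) (h.trans (ENNReal.ofReal_le_ofReal hη))
  rintro x hx hx'
  exact hx ⟨hx'.1.trans hT, hQ _ hx'.2⟩

theorem Spec.and {m : RandComp α} {T η₁ η₂ : ℝ} {Q₁ Q₂ : α → Prop} (h₁ : m.Spec T η₁ Q₁)
    (h₂ : m.Spec T η₂ Q₂) (hη₁ : 0 ≤ η₁) (hη₂ : 0 ≤ η₂) :
    m.Spec T (η₁ + η₂) fun a => Q₁ a ∧ Q₂ a := by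
  rw [Spec, ENNReal.ofReal_add hη₁ hη₂]
  refine le_trans ?_ (add_le_add h₁ h₂)
  refine le_trans (m.prob_mono ?_) (measure_union_le (μ := m.law.toOuterMeasure) _ _)
  rintro x hx
  by_contra h
  simp only [Set.mem_union, Set.mem_ofPred_eq, not_or, not_not] at h hx
  exact hx ⟨h.1.1, h.1.2, h.2.2⟩

theorem Spec.charge {t : ℕ} {a : α} {Q : α → Prop} (h : Q a) : (charge t a).Spec t 0 Q := by
  rw [Spec, prob_def, law_charge, PMF.toOuterMeasure_pure_apply, if_neg (by simpa using h)]
  simp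

theorem Spec.op {a : α} {Q : α → Prop} (h : Q a) : (op a).Spec 1 0 Q := by
  exact_mod_cast Spec.charge (t := 1) h

theorem Spec.pure {a : α} {Q : α → Prop} (h : Q a) : (pure a : RandComp α).Spec 0 0 Q := by
  exact_mod_cast Spec.charge (t := 0) h

theorem Spec.draw (p : PMF α) : (draw p).Spec 1 0 fun _ => True := by
  rw [Spec, prob_def, law_draw, PMF.toOuterMeasure_map_apply]
  simp

/-- Union bound: a bad outcome of `m` is charged in full, and after a good one the continuation,
which uses fresh randomness, fails with probability at most `η₂`. No independence beyond the law of
`bind` is needed. -/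
theorem Spec.bind {m : RandComp α} {f : α → RandComp β} {T₁ T₂ η₁ η₂ : ℝ} {Q : α → Prop}
    {R : β → Prop} (hm : m.Spec T₁ η₁ Q) (hf : ∀ a, Q a → (f a).Spec T₂ η₂ R) (hη₁ : 0 ≤ η₁)
    (hη₂ : 0 ≤ η₂) : (m >>= f).Spec (T₁ + T₂) (η₁ + η₂) R := by
  rw [Spec, prob_bind, ENNReal.ofReal_add hη₁ hη₂]
  set bad : Set (ℕ × α) := {x | ¬((x.1 : ℝ) ≤ T₁ ∧ Q x.2)}
  calc _ ≤ ∑' p : ℕ × α, (bad.indicator m.law p +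
        m.law p * ENNReal.ofReal η₂) := by
        refine ENNReal.tsum_le_tsum fun p => ?_
        by_cases hp : p ∈ bad
        · rw [Set.indicator_of_mem hp]
          exact (mul_le_of_le_one_right' (prob_le_one _ _)).trans le_self_add
        · rw [Set.indicator_of_notMem hp, zero_add]
          simp only [bad, Set.mem_ofPred_eq, not_not] at hp
          refine mul_le_mul_right (le_trans (prob_mono _ ?_) (hf p.2 hp.2)) _
          rintro q hq hq'
          refine hq ⟨?_, hq'.2⟩
          push_cast
          exact add_le_add hp.1 hq'.1
    _ = m.prob bad + ENNReal.ofReal η₂ := by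
        rw [ENNReal.tsum_add, ENNReal.tsum_mul_right, PMF.tsum_coe, one_mul, prob_eq_tsum]
    _ ≤ _ := by gcongr; exact hm

theorem Spec.bind_charge {t : ℕ} {a : α} {f : α → RandComp β} {T η : ℝ} {R : β → Prop}
    (hη : 0 ≤ η) (h : (f a).Spec T η R) : (RandComp.charge t a >>= f).Spec (t + T) η R := by
  simpa using Spec.bind (Spec.charge (Q := fun b => b = a) rfl) (fun b hb => hb ▸ h) le_rfl hη

theorem Spec.bind_op {a : α} {f : α → RandComp β} {T η : ℝ} {R : β → Prop} (hη : 0 ≤ η)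
    (h : (f a).Spec T η R) : (RandComp.op a >>= f).Spec (1 + T) η R := by
  exact_mod_cast Spec.bind_charge (t := 1) hη h

/-- Rule for loops: `I l s` is an invariant of the state `s` when the rounds in `l` remain. -/
theorem Spec.loop (I : List ι → α → Prop) {body : ι → α → RandComp α} {T η : ι → ℝ}
    (hη : ∀ i, 0 ≤ η i)
    (hbody : ∀ i l s, I (i :: l) s → (body i s).Spec (T i) (η i) (I l)) (l : List ι) (s : α)
    (hs : I l s) :
    (loop l s body).Spec (l.map fun i => T i + 1).sum (l.map η).sum (I []) := by
  induction l generalizing s with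
  | nil => simpa [RandComp.loop] using Spec.pure hs
  | cons i l ih =>
    have h0 : 0 ≤ (l.map η).sum := List.sum_nonneg (by simpa using fun a _ => hη a)
    have := Spec.bind (f := fun s => RandComp.op s >>= fun s => RandComp.loop l s body)
      (hbody i l s hs) (fun s' hs' => Spec.bind_op h0 (ih s' hs')) (hη i) h0
    rw [RandComp.loop, List.map_cons, List.map_cons, List.sum_cons, List.sum_cons, add_assoc]
    exact this

theorem Spec.loop_const (I : List ι → α → Prop) {body : ι → α → RandComp α} {T η : ℝ}
    (hη : 0 ≤ η)
    (hbody : ∀ i l s, I (i :: l) s → (body i s).Spec T η (I l)) (l : List ι) (s : α)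
    (hs : I l s) :
    (RandComp.loop l s body).Spec (l.length * (T + 1)) (l.length * η) (I []) := by
  simpa only [List.map_const', List.sum_replicate, nsmul_eq_mul] using
    Spec.loop I (T := fun _ => T) (η := fun _ => η) (fun _ => hη) hbody l s hs

theorem sum_map_elems [Fintype ι] (f : ι → ℝ) : ((elems ι).map f).sum = ∑ i, f i := by
  rw [elems, Finset.sum_map_toList]

theorem mem_elems [Fintype ι] (i : ι) : i ∈ elems ι := by simp [elems]

theorem length_elems [Fintype ι] : (elems ι).length = Fintype.card ι := by
  simp [elems, Finset.card_univ]

theorem Spec.loop_elems [Fintype ι] (I : List ι → α → Prop) {body : ι → α → RandComp α}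
    {T η : ι → ℝ} (hη : ∀ i, 0 ≤ η i)
    (hbody : ∀ i l s, I (i :: l) s → (body i s).Spec (T i) (η i) (I l)) (s : α)
    (hs : I (elems ι) s) :
    (RandComp.loop (elems ι) s body).Spec (∑ i, (T i + 1)) (∑ i, η i) (I []) := by
  simpa only [sum_map_elems] using Spec.loop I hη hbody (elems ι) s hs

theorem Spec.loop_elems_const [Fintype ι] (I : List ι → α → Prop) {body : ι → α → RandComp α}
    {T η : ℝ} (hη : 0 ≤ η)
    (hbody : ∀ i l s, I (i :: l) s → (body i s).Spec T η (I l)) (s : α)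
    (hs : I (elems ι) s) :
    (RandComp.loop (elems ι) s body).Spec (Fintype.card ι * (T + 1)) (Fintype.card ι * η)
      (I []) := by
  simpa only [length_elems] using Spec.loop_const I hη hbody (elems ι) s hs

/-- A loop whose round `i` stores in the entry `i` of an array a number with the property `Q i`. -/
theorem Spec.loop_update [Fintype ι] (Q : ι → ℝ → Prop)
    {body : ι → (ι → ℝ) → RandComp (ι → ℝ)} {T η : ℝ} (hη : 0 ≤ η)
    (hbody : ∀ i x, (body i x).Spec T η fun x' => Q i (x' i) ∧ ∀ j, j ≠ i → x' j = x j)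
    (x : ι → ℝ) :
    (RandComp.loop (elems ι) x body).Spec (Fintype.card ι * (T + 1)) (Fintype.card ι * η)
      fun x' => ∀ i, Q i (x' i) := by
  refine (Spec.loop_elems_const (fun l x' => ∀ i, i ∉ l → Q i (x' i)) hη ?_ x
    fun i hi => absurd (mem_elems i) hi).mono le_rfl le_rfl fun x' h i => h i (by simp)
  intro i l x hx
  refine (hbody i x).mono le_rfl le_rfl ?_
  rintro x' ⟨hi, hne⟩ j hj
  by_cases hji : j = i
  · subst hji; exact hi
  · rw [hne j hji]
    exact hx j (by simp [hji, hj])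

/-- The expectation of a nonnegative function of the result. -/
noncomputable def expect (m : RandComp α) (h : α → ℝ≥0∞) : ℝ≥0∞ :=
  ∑' x : ℕ × α, m.law x * h x.2

end RandComp

/-! ### Expectations of results and Markov's inequality. -/

theorem PMF.tsum_pure_mul {α : Type*} (a : α) (h : α → ℝ≥0∞) :
    ∑' x, PMF.pure a x * h x = h a := by
  rw [tsum_eq_single a fun b hb => by simp [hb]]
  simp

theorem PMF.tsum_bind_mul {α β : Type*} (p : PMF α) (f : α → PMF β) (h : β → ℝ≥0∞) :
    ∑' y, p.bind f y * h y = ∑' x, p x * ∑' y, f x y * h y := by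
  simp_rw [PMF.bind_apply, ← ENNReal.tsum_mul_right, ← ENNReal.tsum_mul_left]
  rw [ENNReal.tsum_comm]
  simp_rw [mul_assoc]

theorem PMF.tsum_map_mul {α β : Type*} (p : PMF α) (f : α → β) (h : β → ℝ≥0∞) :
    ∑' y, p.map f y * h y = ∑' x, p x * h (f x) := by
  rw [PMF.map, PMF.tsum_bind_mul]
  simp_rw [Function.comp_apply, PMF.tsum_pure_mul]

namespace RandComp

variable {α β ι : Type}

theorem expect_bind (m : RandComp α) (f : α → RandComp β) (h : β → ℝ≥0∞) :
    (m >>= f).expect h = m.expect fun a => (f a).expect h := by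
  rw [expect, law_bind, PMF.tsum_bind_mul]
  simp_rw [PMF.tsum_map_mul]
  rfl

theorem expect_op (a : α) (h : α → ℝ≥0∞) : (op a).expect h = h a := by
  rw [expect, law_op, PMF.tsum_pure_mul]

theorem expect_pure (a : α) (h : α → ℝ≥0∞) : (pure a : RandComp α).expect h = h a := by
  rw [expect, law_pure, PMF.tsum_pure_mul]

theorem expect_draw (p : PMF α) (h : α → ℝ≥0∞) : (draw p).expect h = ∑' x, p x * h x := by
  rw [expect, law_draw, PMF.tsum_map_mul]

/-- Markov's inequality. -/
theorem prob_le_expect (m : RandComp α) (Q : α → Prop) (h : α → ℝ≥0∞) (hQ : ∀ a, Q a → 1 ≤ h a) :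
    m.prob {x | Q x.2} ≤ m.expect h := by
  rw [prob_eq_tsum, expect]
  refine ENNReal.tsum_le_tsum fun x => ?_
  by_cases hx : Q x.2
  · rw [Set.indicator_of_mem (by exact hx)]
    exact le_mul_of_one_le_right' (hQ _ hx)
  · rw [Set.indicator_of_notMem (by exact hx)]
    exact zero_le

end RandComp

/-! ### Approximate transitions -/

section Hoeffding

/-- Hoeffding's lemma for a law on a finite type. -/
theorem PMF.sum_mul_exp_le {α : Type*} [Fintype α] (p : PMF α) (X : α → ℝ) {M : ℝ}
    (hX : ∀ a, |X a| ≤ M) (θ : ℝ) :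
    ∑ a, (p a).toReal * Real.exp (θ * X a) ≤
      Real.exp (θ * ∑ a, (p a).toReal * X a + θ ^ 2 * M ^ 2 / 2) := by
  let _ : MeasurableSpace α := ⊤
  have _ : MeasurableSingletonClass α := ⟨fun _ => trivial⟩
  have hM : 0 ≤ M := by
    obtain ⟨a, -⟩ := p.support_nonempty
    exact (abs_nonneg _).trans (hX a)
  -- On [-M, M] the variance proxy ((M - (-M)) / 2)² equals M².
  have h := (hasSubgaussianMGF_of_mem_Icc (μ := p.toMeasure) (X := X) (a := -M) (b := M)
    (measurable_of_finite X).aemeasurable (ae_of_all _ fun a => abs_le.1 (hX a))).mgf_le θ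
  rw [mgf, PMF.integral_eq_sum, PMF.integral_eq_sum] at h
  simp only [smul_eq_mul] at h
  have hc : ((((‖M - -M‖₊ / 2) ^ 2 : NNReal)) : ℝ) = M ^ 2 := by
    push_cast
    rw [sub_neg_eq_add, Real.norm_of_nonneg (by linarith)]
    ring
  rw [hc] at h
  set μ := ∑ a, (p a).toReal * X a
  calc _ = Real.exp (θ * μ) * ∑ a, (p a).toReal * Real.exp (θ * (X a - μ)) := by
        rw [Finset.mul_sum]
        refine Finset.sum_congr rfl fun a _ => ?_
        rw [mul_left_comm, ← Real.exp_add]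
        ring_nf
    _ ≤ Real.exp (θ * μ) * Real.exp (M ^ 2 * θ ^ 2 / 2) := by gcongr
    _ = _ := by rw [← Real.exp_add]; ring_nf

end Hoeffding

/-! ### Concentration of sequentially drawn samples. -/

namespace RandComp

variable {α ι : Type}

/-- The sum of the values of `X` at samples of `p` that are drawn one by one. -/
noncomputable def sumSamples (p : PMF α) (X : α → ℝ) (l : List ι) (s : ℝ) : RandComp ℝ :=
  loop l s fun _ s => do
    let o ← draw p
    let y ← op (X o)
    op (s + y)

/-- Each fresh draw multiplies the exponential moment by at most exp κ, by Hoeffding's lemma.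
Induction along the loop thus replaces an appeal to independent random variables. -/
theorem expect_sumSamples_le [Fintype α] (p : PMF α) (X : α → ℝ) {M : ℝ} (hX : ∀ a, |X a| ≤ M)
    (θ : ℝ) (l : List ι) (s : ℝ) :
    (sumSamples p X l s).expect (fun s => ENNReal.ofReal (Real.exp (θ * s))) ≤
      ENNReal.ofReal (Real.exp (θ * s + l.length *
        (θ * ∑ a, (p a).toReal * X a + θ ^ 2 * M ^ 2 / 2))) := by
  set κ := θ * ∑ a, (p a).toReal * X a + θ ^ 2 * M ^ 2 / 2
  induction l generalizing s with
  | nil => simp [sumSamples, loop, expect_pure]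
  | cons i l ih =>
    rw [sumSamples, loop]
    simp only [expect_bind, expect_op, expect_draw]
    refine (ENNReal.tsum_le_tsum fun a => mul_le_mul_right (ih (s + X a)) (p a)).trans ?_
    rw [tsum_fintype]
    calc _ = ∑ a, ENNReal.ofReal ((p a).toReal * Real.exp (θ * (s + X a) + l.length * κ)) := by
          refine Finset.sum_congr rfl fun a _ => ?_
          rw [ENNReal.ofReal_mul ENNReal.toReal_nonneg, ENNReal.ofReal_toReal (p.apply_ne_top a)]
      _ = ENNReal.ofReal (Real.exp (θ * s + l.length * κ) *
            ∑ a, (p a).toReal * Real.exp (θ * X a)) := by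
          rw [← ENNReal.ofReal_sum_of_nonneg fun a _ => by positivity, Finset.mul_sum]
          congr 1
          refine Finset.sum_congr rfl fun a _ => ?_
          rw [mul_left_comm, ← Real.exp_add]
          ring_nf
      _ ≤ _ := by
          refine ENNReal.ofReal_le_ofReal ?_
          refine (mul_le_mul_of_nonneg_left (p.sum_mul_exp_le X hX θ) (Real.exp_nonneg _)).trans ?_
          rw [← Real.exp_add]
          refine (Real.exp_le_exp.2 ?_)
          rw [List.length_cons]
          push_cast
          exact le_of_eq (by ring)

/-- Four steps per sample: the draw, the reading of `X`, the addition, and the management of the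
loop. -/
theorem spec_sumSamples_time (p : PMF α) (X : α → ℝ) (l : List ι) (s : ℝ) :
    (sumSamples p X l s).Spec (4 * l.length) 0 fun _ => True := by
  have hbody : ∀ s : ℝ, (draw p >>= fun o => op (X o) >>= fun y => op (s + y)).Spec
      (1 + (1 + 1)) (0 + 0) fun _ => True := fun s =>
    Spec.bind (Spec.draw p) (fun o _ => Spec.bind_op le_rfl (Spec.op (Q := fun _ => True) trivial))
      le_rfl le_rfl
  exact (Spec.loop_const (fun _ _ => True) (by simp) (fun _ _ s _ => hbody s) l s trivial).mono
    (le_of_eq (by ring)) (le_of_eq (by ring)) fun _ h => h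

theorem expect_const_mul (m : RandComp α) (c : ℝ≥0∞) (h : α → ℝ≥0∞) :
    m.expect (fun a => c * h a) = c * m.expect h := by
  rw [expect, expect, ← ENNReal.tsum_mul_left]
  exact tsum_congr fun _ => mul_left_comm _ _ _

/-- The Chernoff bound for a sum of samples, for the upper (`σ = 1`) and lower (`σ = -1`) tails. -/
theorem prob_sumSamples_le [Fintype α] (p : PMF α) (X : α → ℝ) {M ε θ σ : ℝ} (hθ : 0 ≤ θ)
    (hσ : σ ^ 2 = 1) (hX : ∀ a, |X a| ≤ M) (l : List ι) :
    (sumSamples p X l 0).prob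
        {x | l.length * ε < σ * (x.2 - l.length * ∑ a, (p a).toReal * X a)} ≤
      ENNReal.ofReal (Real.exp (l.length * (θ ^ 2 * M ^ 2 / 2 - θ * ε))) := by
  set μ := ∑ a, (p a).toReal * X a
  refine (prob_le_expect _ (fun s => l.length * ε < σ * (s - l.length * μ)) (fun s => ENNReal.ofReal
    (Real.exp (-(θ * (l.length * (ε + σ * μ))))) *
      ENNReal.ofReal (Real.exp (θ * σ * s))) ?_).trans ?_
  · intro s hs
    rw [← ENNReal.ofReal_mul (Real.exp_nonneg _), ← Real.exp_add, ENNReal.one_le_ofReal]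
    refine Real.one_le_exp ?_
    have := mul_le_mul_of_nonneg_left hs.le hθ
    linarith
  · rw [expect_const_mul]
    refine (mul_le_mul_right (expect_sumSamples_le p X hX (θ * σ) l 0) _).trans ?_
    rw [← ENNReal.ofReal_mul (Real.exp_nonneg _), ← Real.exp_add]
    refine ENNReal.ofReal_le_ofReal (Real.exp_le_exp.2 (le_of_eq ?_))
    rw [mul_pow, hσ]
    ring

/-- Hoeffding's inequality for the empirical mean. -/
theorem spec_sumSamples [Fintype α] (p : PMF α) (X : α → ℝ) {M ε δ : ℝ} (hε : 0 < ε) (hδ : 0 < δ)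
    (hδ' : δ ≤ 1) (hX : ∀ a, |X a| ≤ M) {m : ℕ}
    (hm : 2 * M ^ 2 / ε ^ 2 * Real.log (2 / δ) ≤ m) :
    (sumSamples p X (List.range m) 0).Spec (4 * m) δ fun s =>
      |s / m - ∑ a, (p a).toReal * X a| ≤ ε := by
  have hlog : 0 < Real.log (2 / δ) := Real.log_pos (by rw [lt_div_iff₀ hδ]; linarith)
  have hM : 0 ≤ M := by
    obtain ⟨a, -⟩ := p.support_nonempty
    exact (abs_nonneg _).trans (hX a)
  set μ := ∑ a, (p a).toReal * X a with hμ
  have htime : (sumSamples p X (List.range m) 0).Spec (4 * m) 0 fun _ => True := by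
    simpa using spec_sumSamples_time p X (List.range m) 0
  -- No samples are drawn only if M = 0. Then X vanishes, and so does the returned mean, since
  -- division by zero gives 0.
  rcases Nat.eq_zero_or_pos m with rfl | hmpos
  · refine htime.mono le_rfl hδ.le fun s _ => ?_
    have h0 : M = 0 := by
      by_contra h
      have : 0 < M := lt_of_le_of_ne hM (Ne.symm h)
      have : 0 < 2 * M ^ 2 / ε ^ 2 * Real.log (2 / δ) := by positivity
      simp only [Nat.cast_zero] at hm
      linarith
    have hX0 : ∀ a, X a = 0 := fun a => abs_nonpos_iff.1 (h0 ▸ hX a)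
    simp [hμ, hX0, hε.le]
  have hm0 : (0 : ℝ) < m := by exact_mod_cast hmpos
  -- For M > 0 the minimizer θ = ε / M² of the Chernoff exponent gives -m ε² / (2M²). For M = 0 the
  -- exponent is linear in θ, and θ is chosen to give equality.
  obtain ⟨θ, hθ, hexp⟩ : ∃ θ : ℝ, 0 ≤ θ ∧
      (m : ℝ) * (θ ^ 2 * M ^ 2 / 2 - θ * ε) ≤ -Real.log (2 / δ) := by
    rcases hM.eq_or_lt with h0 | hpos
    · refine ⟨Real.log (2 / δ) / (m * ε), by positivity, le_of_eq ?_⟩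
      rw [← h0]
      field_simp
      ring
    · refine ⟨ε / M ^ 2, by positivity, ?_⟩
      have h1 : (m : ℝ) * ((ε / M ^ 2) ^ 2 * M ^ 2 / 2 - ε / M ^ 2 * ε) =
          -(m * (ε ^ 2 / (2 * M ^ 2))) := by
        field_simp
        ring
      rw [h1, neg_le_neg_iff]
      calc Real.log (2 / δ) = 2 * M ^ 2 / ε ^ 2 * Real.log (2 / δ) * (ε ^ 2 / (2 * M ^ 2)) := by
            field_simp
        _ ≤ _ := by gcongr
  have htail : ∀ σ : ℝ, σ ^ 2 = 1 → (sumSamples p X (List.range m) 0).Spec (4 * m) (δ / 2)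
      fun s => σ * (s - m * μ) ≤ m * ε := by
    intro σ hσ
    have h1 : (sumSamples p X (List.range m) 0).prob {x | ¬ (σ * (x.2 - m * μ) ≤ m * ε)} ≤
        ENNReal.ofReal (δ / 2) := by
      have := prob_sumSamples_le p X (ε := ε) hθ hσ hX (List.range m)
      rw [List.length_range] at this
      simp only [not_le]
      refine this.trans (ENNReal.ofReal_le_ofReal ?_)
      calc Real.exp _ ≤ Real.exp (-Real.log (2 / δ)) := Real.exp_le_exp.2 hexp
        _ = δ / 2 := by rw [Real.exp_neg, Real.exp_log (by positivity), inv_div]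
    rw [Spec] at htime ⊢
    refine le_trans (prob_mono _ ?_) ((measure_union_le (μ := (law _).toOuterMeasure) _ _).trans
      (add_le_add htime h1) |>.trans (le_of_eq (by simp)))
    rintro x hx
    by_contra h
    simp only [Set.mem_union, Set.mem_ofPred_eq, not_or, not_not] at h hx
    exact hx ⟨h.1.1, h.2⟩
  refine (Spec.and (htail 1 (by norm_num)) (htail (-1) (by norm_num)) (by positivity)
    (by positivity)).mono le_rfl (by linarith) ?_
  rintro s ⟨h1, h2⟩
  have h3 : s / m - μ = (s - m * μ) / m := by field_simp
  rw [h3, abs_div, abs_of_pos hm0, div_le_iff₀ hm0, abs_le]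
  constructor <;> linarith

end RandComp

theorem cemeteryLaw_sum {S : Type} [Fintype S] (p : S → ℝ) (h0 : ∀ j, 0 ≤ p j)
    (h1 : ∑ j, p j ≤ 1) (X : Option S → ℝ) (hX : X none = 0) :
    ∑ o, (cemeteryLaw p h0 h1 o).toReal * X o = ∑ j, p j * X (some j) := by
  rw [Fintype.sum_option, hX, mul_zero, zero_add]
  refine Finset.sum_congr rfl fun j _ => ?_
  rw [cemeteryLaw, PMF.ofFintype_apply, ENNReal.toReal_ofReal (h0 j)]

namespace StructuredGame

variable {S : Type} [Fintype S]
  {A : S → Type} {B : ∀ i, A i → Type}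

/-- Hoeffding for the law with cemetery, where the cemetery contributes 0 to the mean. The 13
consists of eight preparatory steps, the final division, and four steps for the sample added by
rounding up. -/
theorem spec_apxTransC (g : StructuredGame S A B) (u : S → ℝ) {M : ℝ} (hu : ∀ i, |u i| ≤ M)
    (hM : 0 ≤ M) (i : S) (a : A i) (b : B i a) {ε δ : ℝ} (hε : 0 < ε) (hδ : 0 < δ) (hδ' : δ ≤ 1) :
    (g.apxTransC u M i a b ε δ).Spec (8 * M ^ 2 / ε ^ 2 * Real.log (2 / δ) + 13) δ
      fun y => |y - ∑ j, g.P i a b j * u j| ≤ ε := by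
  have hlog : 0 ≤ Real.log (2 / δ) := Real.log_nonneg (by rw [le_div_iff₀ hδ]; linarith)
  let X : Option S → ℝ := fun o => match o with
    | none => 0
    | some j => u j
  have hX : ∀ o, |X o| ≤ M := by
    rintro (_ | j)
    · simpa [X] using hM
    · exact hu j
  set t := 2 * M ^ 2 / ε ^ 2 * Real.log (2 / δ) with ht
  have ht0 : 0 ≤ t := by positivity
  have hs := RandComp.spec_sumSamples
    (cemeteryLaw (g.P i a b) (g.P_nonneg i a b) (g.P_sum_le i a b)) X hε hδ hδ' hX (Nat.le_ceil t)
  rw [cemeteryLaw_sum _ _ _ X rfl] at hs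
  have hmain := RandComp.Spec.bind hs (fun s hs => RandComp.Spec.op
    (Q := fun y => |y - ∑ j, g.P i a b j * u j| ≤ ε) hs) hδ.le le_rfl
  have hceil := Nat.ceil_lt_add_one ht0
  have h8 : 8 * M ^ 2 / ε ^ 2 * Real.log (2 / δ) = 4 * t := by rw [ht]; ring
  refine RandComp.Spec.mono (T := 1 + (1 + (1 + (1 + (1 + (1 + (1 + (1 + (4 * ⌈t⌉₊ + 1)))))))))
    (η := δ + 0) ?_ (by linarith) (by linarith) (fun _ h => h)
  have h0 : 0 ≤ δ + 0 := by linarith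
  unfold apxTransC
  iterate 8 refine RandComp.Spec.bind_op h0 ?_
  exact hmain

end StructuredGame

/-! ### Expected hitting times -/

section HittingTimeEquation

variable {S : Type} [Fintype S]

theorem chainLaw_isProbability (Q : S → PMF S) (i : S) :
    @IsProbabilityMeasure _ (@MeasurableSpace.pi _ _ fun _ => ⊤) (chainLaw Q i) := by
  let _ : MeasurableSpace S := ⊤
  have := chainKernel_isMarkov Q
  exact inferInstanceAs (IsProbabilityMeasure
    (Kernel.traj (X := fun _ => S) (chainKernel Q) 0 (fun _ => i)))

theorem lintegral_chainLaw_zero (Q : S → PMF S) (i : S) (f : S → ℝ≥0∞) :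
    @lintegral _ (@MeasurableSpace.pi _ _ fun _ => ⊤) (chainLaw Q i) (fun X => f (X 0)) = f i := by
  let _ : MeasurableSpace S := ⊤
  have : MeasurableSingletonClass S := ⟨fun _ => trivial⟩
  have := chainKernel_isMarkov Q
  have := chainLaw_isProbability Q i
  have hm : Measurable fun X : ℕ → S => f (X 0) :=
    (measurable_of_finite f).comp (measurable_pi_apply 0)
  change ∫⁻ X, f (X 0) ∂(Kernel.traj (X := fun _ => S) (chainKernel Q) 0 (fun _ => i)) = f i
  rw [Kernel.lintegral_traj _ hm]
  simp [Function.updateFinset]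

/-- The Markov property at time `n`. -/
theorem lintegral_chainLaw_succ (Q : S → PMF S) (i : S) (n : ℕ)
    (F : (Finset.Iic n → S) → S → ℝ≥0∞) :
    @lintegral _ (@MeasurableSpace.pi _ _ fun _ => ⊤) (chainLaw Q i)
        (fun X => F (Preorder.frestrictLe n X) (X (n + 1))) =
      @lintegral _ (@MeasurableSpace.pi _ _ fun _ => ⊤) (chainLaw Q i)
        (fun X => ∑ j, Q (X n) j * F (Preorder.frestrictLe n X) j) := by
  let _ : MeasurableSpace S := ⊤
  have : MeasurableSingletonClass S := ⟨fun _ => trivial⟩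
  have := chainKernel_isMarkov Q
  let μ := Kernel.traj (X := fun _ => S) (chainKernel Q) 0 (fun _ => i)
  change ∫⁻ X, F (Preorder.frestrictLe n X) (X (n + 1)) ∂μ =
    ∫⁻ X, ∑ j, Q (X n) j * F (Preorder.frestrictLe n X) j ∂μ
  have hF : Measurable fun p : (Finset.Iic n → S) × S => F p.1 p.2 := measurable_of_countable _
  -- The joint law of the states up to time n and the next state is the composition product of the
  -- law of the partial trajectory with the kernel at time n.
  have h1 := lintegral_map (μ := μ) hF (g := fun X => (Preorder.frestrictLe n X, X (n + 1)))
    (by fun_prop)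
  rw [← Kernel.partialTraj_compProd_eq_map_traj (Nat.zero_le n), Measure.lintegral_compProd hF,
    ← Kernel.traj_map_frestrictLe_apply, lintegral_map (measurable_of_countable _) (by fun_prop)]
    at h1
  rw [← h1]
  refine lintegral_congr fun X => ?_
  rw [lintegral_fintype]
  refine Finset.sum_congr rfl fun j _ => ?_
  rw [mul_comm]
  congr 1
  change (Q (X n)).toMeasure {j} = _
  rw [PMF.toMeasure_apply_singleton _ _ (measurableSet_singleton j)]

open Classical in
/-- One step of the chain, killed when it enters `c`. -/
noncomputable def killedStep (Q : S → PMF S) (c : S) (f : S → ℝ≥0∞) (i : S) : ℝ≥0∞ :=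
  ∑ j, Q i j * if j = c then 0 else f j

-- For f = 1 this is the probability that the hitting time exceeds n. The Markov property at time n
-- converts the last step into one application of `killedStep` to f, hence the induction with f
-- general. Time 0 is not tested, so a start at c counts the return to c.
open Classical in
theorem lintegral_chainLaw_killed (Q : S → PMF S) (c i : S) (n : ℕ) (f : S → ℝ≥0∞) :
    @lintegral _ (@MeasurableSpace.pi _ _ fun _ => ⊤) (chainLaw Q i)
        (fun X => if ∀ m, 1 ≤ m → m ≤ n → X m ≠ c then f (X n) else 0) =
      (killedStep Q c)^[n] f i := by
  induction n generalizing f with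
  | zero =>
    rw [Function.iterate_zero, id, ← lintegral_chainLaw_zero Q i f]
    congr 1
    ext X
    rw [if_pos]
    intro m h1 h2
    lia
  | succ n ih =>
    rw [Function.iterate_succ_apply, ← ih]
    have h := lintegral_chainLaw_succ Q i n fun y j =>
      if ∀ m (hm : m ≤ n), 1 ≤ m → y ⟨m, Finset.mem_Iic.2 hm⟩ ≠ c then
        (if j = c then 0 else f j) else 0
    refine Eq.trans ?_ (h.trans ?_)
    · congr 1
      ext X
      by_cases h1 : ∀ m, 1 ≤ m → m ≤ n → X m ≠ c
      · have hp : ∀ m (hm : m ≤ n), 1 ≤ m →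
            Preorder.frestrictLe n X ⟨m, Finset.mem_Iic.2 hm⟩ ≠ c := fun m hm h2 => h1 m h2 hm
        rw [if_pos hp]
        by_cases h2 : X (n + 1) = c
        · rw [if_neg fun h => h (n + 1) (by lia) le_rfl h2, if_pos h2]
        · rw [if_neg h2, if_pos]
          intro m hm hm'
          rcases hm'.eq_or_lt with rfl | hlt
          · exact h2
          · exact h1 m hm (by lia)
      · rw [if_neg fun h => h1 fun m hm hm' => h m hm (by lia),
          if_neg fun h => h1 fun m hm hm' => h m hm' hm]
    · congr 1
      ext X
      by_cases h1 : ∀ m, 1 ≤ m → m ≤ n → X m ≠ c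
      · have hp : ∀ m (hm : m ≤ n), 1 ≤ m →
            Preorder.frestrictLe n X ⟨m, Finset.mem_Iic.2 hm⟩ ≠ c := fun m hm h2 => h1 m h2 hm
        rw [if_pos h1, killedStep]
        refine Finset.sum_congr rfl fun j _ => ?_
        rw [if_pos hp]
      · rw [if_neg h1]
        refine Finset.sum_eq_zero fun j _ => ?_
        rw [if_neg fun h => h1 fun m hm hm' => h m hm' hm, mul_zero]

-- A time is the sum over n ≥ 0 of the indicators that it exceeds n; if c is never reached, both
-- sides are infinite.
open Classical in
theorem hittingTime_eq_tsum {S : Type} (c : S) (X : ℕ → S) :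
    hittingTime c X = ∑' n : ℕ, if ∀ m, 1 ≤ m → m ≤ n → X m ≠ c then (1 : ℝ≥0∞) else 0 := by
  by_cases h : ∃ k, 1 ≤ k ∧ X k = c
  · set N := Nat.find h
    obtain ⟨hN1, hNc⟩ : 1 ≤ N ∧ X N = c := Nat.find_spec h
    have hlt : ∀ m, 1 ≤ m → m < N → X m ≠ c := fun m hm hmN hc => Nat.find_min h hmN ⟨hm, hc⟩
    have h1 : hittingTime c X = N := by
      refine le_antisymm (iInf₂_le N ⟨hN1, hNc⟩) (le_iInf₂ fun k hk => ?_)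
      exact_mod_cast Nat.find_min' h hk
    rw [h1, tsum_eq_sum (s := Finset.range N)]
    · have h2 : ∀ n ∈ Finset.range N,
          (if ∀ m, 1 ≤ m → m ≤ n → X m ≠ c then (1 : ℝ≥0∞) else 0) = 1 := fun n hn =>
        if_pos fun m hm hm' => hlt m hm (lt_of_le_of_lt hm' (Finset.mem_range.1 hn))
      rw [Finset.sum_congr rfl h2]
      simp
    · intro n hn
      rw [if_neg fun h' => h' N hN1 (by simpa using hn) hNc]
  · push Not at h
    have h1 : hittingTime c X = ⊤ := by
      simp only [hittingTime, iInf_eq_top]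
      exact fun k hk => absurd hk.2 (h k hk.1)
    have h2 : ∀ n : ℕ, (if ∀ m, 1 ≤ m → m ≤ n → X m ≠ c then (1 : ℝ≥0∞) else 0) = 1 := fun n =>
      if_pos fun m hm _ => h m hm
    rw [h1, tsum_congr h2]
    exact (ENNReal.tsum_const_eq_top_of_ne_zero one_ne_zero).symm

theorem expectedHittingTime_eq_tsum (Q : S → PMF S) (i c : S) :
    expectedHittingTime Q i c = ∑' n : ℕ, (killedStep Q c)^[n] 1 i := by
  classical
  let _ : MeasurableSpace S := ⊤
  have : MeasurableSingletonClass S := ⟨fun _ => trivial⟩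
  have hm : ∀ n : ℕ, Measurable fun X : ℕ → S =>
      if ∀ m, 1 ≤ m → m ≤ n → X m ≠ c then (1 : ℝ≥0∞) else 0 := by
    intro n
    refine Measurable.ite ?_ measurable_const measurable_const
    simp only [Set.ofPred_forall]
    refine MeasurableSet.iInter fun m => MeasurableSet.iInter fun _ => MeasurableSet.iInter fun _ => ?_
    exact measurable_pi_apply (X := fun _ : ℕ => S) m (measurableSet_singleton c).compl
  rw [expectedHittingTime, funext (hittingTime_eq_tsum c),
    lintegral_tsum fun n => (hm n).aemeasurable]
  exact tsum_congr fun n => lintegral_chainLaw_killed Q c i n 1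

/-- First step analysis. -/
theorem expectedHittingTime_eq_add (Q : S → PMF S) (i c : S) :
    expectedHittingTime Q i c = 1 + killedStep Q c (fun j => expectedHittingTime Q j c) i := by
  rw [expectedHittingTime_eq_tsum, tsum_eq_zero_add' ENNReal.summable]
  congr 1
  simp only [expectedHittingTime_eq_tsum, Function.iterate_succ_apply', killedStep]
  rw [Summable.tsum_finsetSum fun _ _ => ENNReal.summable]
  refine Finset.sum_congr rfl fun j _ => ?_
  rw [ENNReal.tsum_mul_left]
  congr 1
  split_ifs <;> simp

end HittingTimeEquation

/-! ### The optimality equation for maximal hitting times. -/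

namespace MeanPayoffGame

variable {S : Type} [Fintype S] {A : S → Type} {B : ∀ i, A i → Type}

theorem deflatedP_nonneg (g : MeanPayoffGame S A B) (c i : S) (a : A i) (b : B i a) (j : S) :
    0 ≤ g.deflatedP c i a b j := by
  unfold deflatedP
  split_ifs
  exacts [le_rfl, g.P_nonneg _ _ _ _]

theorem sum_deflatedP_le (g : MeanPayoffGame S A B) (c i : S) (a : A i) (b : B i a) :
    ∑ j, g.deflatedP c i a b j ≤ 1 := by
  rw [← g.P_sum i a b]
  refine Finset.sum_le_sum fun j _ => ?_
  unfold deflatedP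
  split_ifs
  exacts [g.P_nonneg _ _ _ _, le_rfl]

/-- First step analysis in real numbers, which finiteness permits; killing at c amounts to deleting
column c. -/
theorem toReal_expectedHittingTime_eq (g : MeanPayoffGame S A B) (c : S) (σ : ∀ i, A i)
    (τ : ∀ i a, B i a) (hfin : ∀ i, expectedHittingTime (g.policyChain σ τ) i c ≠ ⊤) (i : S) :
    (expectedHittingTime (g.policyChain σ τ) i c).toReal =
      1 + ∑ j, g.deflatedP c i (σ i) (τ i (σ i)) j *
        (expectedHittingTime (g.policyChain σ τ) j c).toReal := by
  classical
  have h := expectedHittingTime_eq_add (g.policyChain σ τ) i c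
  have hterm : ∀ j, ((g.policyChain σ τ) i j *
      if j = c then 0 else expectedHittingTime (g.policyChain σ τ) j c) ≠ ⊤ := fun j =>
    ENNReal.mul_ne_top (PMF.apply_ne_top _ _) (by split_ifs; exacts [ENNReal.zero_ne_top, hfin j])
  have hsum : killedStep (g.policyChain σ τ) c
      (fun j => expectedHittingTime (g.policyChain σ τ) j c) i ≠ ⊤ := by
    intro h'
    exact hfin i (by rw [h, h']; simp)
  conv_lhs => rw [h]
  rw [ENNReal.toReal_add ENNReal.one_ne_top hsum, ENNReal.toReal_one, killedStep,
    ENNReal.toReal_sum fun j _ => by convert hterm j]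
  congr 1
  refine Finset.sum_congr rfl fun j _ => ?_
  rw [ENNReal.toReal_mul, policyChain, rowLaw, PMF.ofFintype_apply,
    ENNReal.toReal_ofReal (g.P_nonneg _ _ _ _), deflatedP]
  split_ifs <;> simp

/-- If `x ≥ p x` for a nonnegative matrix `p` that has a finite positive solution `h = 1 + p h`,
then `x ≥ 0`. -/
theorem nonneg_of_superharmonic [Nonempty S] {p : S → S → ℝ} (hp : ∀ i j, 0 ≤ p i j) {h x : S → ℝ}
    (h_pos : ∀ i, 0 < h i) (h_eq : ∀ i, h i = 1 + ∑ j, p i j * h j)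
    (hx : ∀ i, ∑ j, p i j * x j ≤ x i) (i : S) : 0 ≤ x i := by
  -- Minimum principle for the ratio x / h: at a minimizer k with value m, the hypotheses give m (h
  -- k - 1) ≤ x k = m h k, so m ≥ 0.
  obtain ⟨k, hk⟩ := Finite.exists_min fun i => x i / h i
  set m := x k / h k with hm
  have hle : ∀ j, m * h j ≤ x j := fun j => by
    rw [← le_div_iff₀ (h_pos j)]
    exact hk j
  have hxk : x k = m * h k := by rw [hm, div_mul_cancel₀ _ (h_pos k).ne']
  have h1 : m * (h k - 1) ≤ x k := by
    calc m * (h k - 1) = ∑ j, p k j * (m * h j) := by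
          rw [h_eq k, add_sub_cancel_left, Finset.mul_sum]
          exact Finset.sum_congr rfl fun j _ => by ring
      _ ≤ ∑ j, p k j * x j := Finset.sum_le_sum fun j _ => mul_le_mul_of_nonneg_left (hle j) (hp k j)
      _ ≤ x k := hx k
  have hm0 : 0 ≤ m := by rw [hxk] at h1; linarith
  exact (mul_nonneg hm0 (h_pos i).le).trans (hle i)

/-- Some pair of policies attains the maximal hitting times from all states, and the vector of the
maximal hitting times solves the optimality equation. -/
theorem maxHittingTime_optimality [∀ i, Fintype (A i)] [∀ i, Nonempty (A i)]
    [∀ i a, Fintype (B i a)] [∀ i a, Nonempty (B i a)] (g : MeanPayoffGame S A B) (c : S)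
    (hfin : ∀ i, g.maxHittingTime c i ≠ ⊤) :
    (∀ i a b, 1 + ∑ j, g.deflatedP c i a b j * (g.maxHittingTime c j).toReal ≤
      (g.maxHittingTime c i).toReal) ∧
    ∀ i, ∃ a b, (g.maxHittingTime c i).toReal =
      1 + ∑ j, g.deflatedP c i a b j * (g.maxHittingTime c j).toReal := by
  classical
  have : Nonempty S := ⟨c⟩
  let Pol := (∀ i, A i) × (∀ i a, B i a)
  have : Nonempty Pol := ⟨(fun _ => Classical.arbitrary _, fun _ _ => Classical.arbitrary _)⟩
  let e : Pol → S → ℝ≥0∞ := fun π i => expectedHittingTime (g.policyChain π.1 π.2) i c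
  let h : Pol → S → ℝ := fun π i => (e π i).toReal
  let p : Pol → S → S → ℝ := fun π i => g.deflatedP c i (π.1 i) (π.2 i (π.1 i))
  have he_le : ∀ π i, e π i ≤ g.maxHittingTime c i := fun π i =>
    le_iSup₂ (f := fun σ τ => expectedHittingTime (g.policyChain σ τ) i c) π.1 π.2
  have he : ∀ π i, e π i ≠ ⊤ := fun π i => ne_top_of_le_ne_top (hfin i) (he_le π i)
  have h_eq : ∀ π i, h π i = 1 + ∑ j, p π i j * h π j := fun π i =>
    g.toReal_expectedHittingTime_eq c π.1 π.2 (he π) i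
  have hp0 : ∀ π i j, 0 ≤ p π i j := fun π i j => g.deflatedP_nonneg _ _ _ _ _
  have h_pos : ∀ π i, 0 < h π i := fun π i => by
    rw [h_eq]
    have : 0 ≤ ∑ j, p π i j * h π j :=
      Finset.sum_nonneg fun j _ => mul_nonneg (hp0 π i j) ENNReal.toReal_nonneg
    linarith
  have hsub : ∀ (π : Pol) (x y : S → ℝ) (i : S), ∑ j, p π i j * (x j - y j) =
      ∑ j, p π i j * x j - ∑ j, p π i j * y j := fun π x y i => by
    rw [← Finset.sum_sub_distrib]
    exact Finset.sum_congr rfl fun j _ => by ring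
  -- A pair maximizing the sum of the hitting times will turn out to be optimal from every state: a
  -- strictly profitable switch at one state would increase the sum.
  obtain ⟨π, hπ⟩ := Finite.exists_max fun π => ∑ i, h π i
  have hopt : ∀ i a b, 1 + ∑ j, g.deflatedP c i a b j * h π j ≤ h π i := by
    intro i a b
    by_contra hlt
    push Not at hlt
    let π' : Pol := (Function.update π.1 i a,
      Function.update π.2 i (Function.update (π.2 i) a b))
    have hp'i : p π' i = g.deflatedP c i a b := by
      -- The type of MAX's action depends on the action of MIN, so the rewriting is done for a
      -- variable `a'`.
      have h1 : ∀ a', a' = a →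
          g.deflatedP c i a' (Function.update (π.2 i) a b a') = g.deflatedP c i a b := by
        rintro _ rfl
        rw [Function.update_self]
      simpa [p, π'] using h1 _ (Function.update_self i a π.1)
    have hp'j : ∀ j, j ≠ i → p π' j = p π j := by
      intro j hj
      have h1 : ∀ a', a' = π.1 j →
          g.deflatedP c j a' (π.2 j a') = g.deflatedP c j (π.1 j) (π.2 j (π.1 j)) := by
        rintro _ rfl
        rfl
      simpa [p, π', Function.update_of_ne hj] using h1 _ (Function.update_of_ne hj a π.1)
    have hstep : ∀ k, h π k ≤ 1 + ∑ j, p π' k j * h π j := by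
      intro k
      by_cases hk : k = i
      · subst hk
        rw [hp'i]
        exact hlt.le
      · rw [hp'j k hk]
        exact (h_eq π k).le
    -- The old vector is a subsolution of the equation of the switched pair, so the minimum
    -- principle shows that no state loses.
    have hnn : ∀ k, 0 ≤ h π' k - h π k := by
      refine nonneg_of_superharmonic (hp0 π') (h_pos π') (h_eq π')
        (x := fun k => h π' k - h π k) fun k => ?_
      rw [hsub]
      have := hstep k
      have := h_eq π' k
      linarith
    have hi : h π i < h π' i := by
      have h1 : 0 ≤ ∑ j, p π' i j * (h π' j - h π j) :=
        Finset.sum_nonneg fun j _ => mul_nonneg (hp0 π' i j) (hnn j)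
      rw [hsub, hp'i] at h1
      have h2 := h_eq π' i
      rw [hp'i] at h2
      linarith
    exact absurd (hπ π') (not_le.2 (Finset.sum_lt_sum (fun k _ => sub_nonneg.1 (hnn k))
      ⟨i, Finset.mem_univ i, hi⟩))
  -- Conversely, by `hopt` the vector of π is a supersolution for every other pair.
  have hmax : ∀ π' i, h π' i ≤ h π i := by
    intro π' i
    refine sub_nonneg.1 (nonneg_of_superharmonic (hp0 π') (h_pos π') (h_eq π')
        (x := fun k => h π k - h π' k) (fun k => ?_) i)
    rw [hsub]
    have := hopt k (π'.1 k) (π'.2 k (π'.1 k))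
    have := h_eq π' k
    linarith
  have ht : ∀ i, g.maxHittingTime c i = e π i := by
    intro i
    refine le_antisymm (iSup₂_le fun σ τ => ?_) (he_le π i)
    exact (ENNReal.toReal_le_toReal (he (σ, τ) i) (he π i)).1 (hmax (σ, τ) i)
  simp only [ht]
  exact ⟨hopt, fun i => ⟨_, _, h_eq π i⟩⟩

theorem one_le_maxHittingTime [∀ i, Fintype (A i)] [∀ i, Nonempty (A i)]
    [∀ i a, Fintype (B i a)] [∀ i a, Nonempty (B i a)] (g : MeanPayoffGame S A B) (c i : S) :
    1 ≤ g.maxHittingTime c i := by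
  refine le_trans ?_ (le_iSup₂ (f := fun σ τ => expectedHittingTime (g.policyChain σ τ) i c)
    (fun _ => Classical.arbitrary _) (fun _ _ => Classical.arbitrary _))
  rw [expectedHittingTime_eq_add]
  exact le_self_add

end MeanPayoffGame

/-! ### Analysis of the sampled-offset algorithm -/

/-- The last clause allows any a priori bound `D` to replace the computed norm in the count of
samples. -/
theorem spec_supNorm {S : Type} [Fintype S] (u : S → ℝ) :
    (supNorm u).Spec (3 * Fintype.card S) 0 fun M =>
      0 ≤ M ∧ (∀ i, |u i| ≤ M) ∧ ∀ D, 0 ≤ D → (∀ i, |u i| ≤ D) → M ≤ D := by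
  refine (RandComp.Spec.loop_elems_const (T := 1 + 1) (fun l M => 0 ≤ M ∧ (∀ i ∉ l, |u i| ≤ M) ∧
    ∀ D, 0 ≤ D → (∀ i, |u i| ≤ D) → M ≤ D) le_rfl ?_ 0
    ⟨le_rfl, fun i hi => absurd (RandComp.mem_elems i) hi, fun D hD _ => hD⟩).mono
    (le_of_eq (by ring)) (by simp) fun M h => ⟨h.1, fun i => h.2.1 i (by simp), h.2.2⟩
  rintro i l M ⟨h0, h1, h2⟩
  refine RandComp.Spec.bind_op le_rfl (RandComp.Spec.op
    (Q := fun M => 0 ≤ M ∧ (∀ i ∉ l, |u i| ≤ M) ∧ ∀ D, 0 ≤ D → (∀ i, |u i| ≤ D) → M ≤ D)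
    ⟨h0.trans (le_max_left _ _), fun j hj => ?_, fun D hD hu => max_le (h2 D hD hu) (hu i)⟩)
  by_cases hji : j = i
  · exact hji ▸ le_max_right _ _
  · exact (h1 j (by simp [hji, hj])).trans (le_max_left _ _)

theorem spec_vecSub {S : Type} [Fintype S] (w w₀ : S → ℝ) :
    (vecSub w w₀).Spec (3 * Fintype.card S) 0 fun d => d = fun i => w i - w₀ i := by
  classical
  refine (RandComp.Spec.loop_update (fun i y => y = w i - w₀ i) (T := 1 + 1) (η := 0) le_rfl
    (fun i x => ?_) (fun _ => 0)).mono (le_of_eq (by ring)) (le_of_eq (by ring)) fun d h => funext h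
  exact RandComp.Spec.bind_op le_rfl (RandComp.Spec.op
    ⟨Function.update_self _ _ _, fun j hj => Function.update_of_ne hj _ _⟩)

/-- Preservation of the invariant of the maximization loop, `l` being the actions still to come: the
stored value is nearly above all treated actions and nearly below some action. -/
theorem RandComp.Spec.keepMax {β : Type} {v : β → ℝ} {η q : ℝ} {b : β} {l : List β}
    {acc : Option (ℝ × β)} (hq : |q - v b| ≤ η)
    (h : (∀ b' ∉ b :: l, ∃ r ∈ acc, v b' - η ≤ r.1) ∧ ∀ r ∈ acc, ∃ b', r.1 ≤ v b' + η) :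
    (∀ b' ∉ l, ∃ r ∈ keepMax acc q b, v b' - η ≤ r.1) ∧
      ∀ r ∈ keepMax acc q b, ∃ b', r.1 ≤ v b' + η := by
  obtain ⟨h1, h2⟩ := abs_le.1 hq
  have hmem : ∀ b' ∉ l, b' ≠ b → b' ∉ b :: l := fun b' hb' hne => by simp [hb', hne]
  rcases acc with _ | ⟨q', b''⟩
  · refine ⟨fun b' hb' => ⟨(q, b), rfl, ?_⟩, ?_⟩
    · by_cases hbb : b' = b
      · subst hbb
        simp only
        linarith
      · obtain ⟨r, hr, -⟩ := h.1 b' (hmem b' hb' hbb)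
        exact absurd hr (by simp)
    · rintro _ ⟨⟩
      exact ⟨b, by simp only; linarith⟩
  · by_cases hlt : q' < q
    · simp only [_root_.keepMax, if_pos hlt]
      refine ⟨fun b' hb' => ⟨(q, b), rfl, ?_⟩, ?_⟩
      · by_cases hbb : b' = b
        · subst hbb
          simp only
          linarith
        · obtain ⟨r, hr, hle⟩ := h.1 b' (hmem b' hb' hbb)
          cases hr
          exact hle.trans hlt.le
      · rintro _ ⟨⟩
        exact ⟨b, by simp only; linarith⟩
    · simp only [_root_.keepMax, if_neg hlt]
      refine ⟨fun b' hb' => ⟨(q', b''), rfl, ?_⟩, h.2⟩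
      by_cases hbb : b' = b
      · subst hbb
        simp only
        linarith
      · obtain ⟨r, hr, hle⟩ := h.1 b' (hmem b' hb' hbb)
        cases hr
        exact hle

/-- `keepMin` selects one of its inputs, so a property common to them survives. As MIN has a single
action, minimality is never needed. -/
theorem keepMin_property {β : Type} {Good : ℝ → Prop} {q : ℝ} {b : β} {acc : Option (ℝ × β)}
    (hq : Good q) (h : ∀ r ∈ acc, Good r.1) :
    keepMin acc q b ≠ none ∧ ∀ r ∈ keepMin acc q b, Good r.1 := by
  rcases acc with _ | ⟨q', b'⟩
  · exact ⟨by simp [keepMin], by rintro _ ⟨⟩; exact hq⟩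
  · by_cases hlt : q < q'
    · simp only [keepMin, if_pos hlt]
      exact ⟨by simp, by rintro _ ⟨⟩; exact hq⟩
    · simp only [keepMin, if_neg hlt]
      exact ⟨by simp, h⟩

/-! ### One approximate value iteration in a unit-cost game. -/

namespace StructuredGame

variable {S : Type} [Fintype S] {B : S → Unit → Type}

/-- The games with operator `w ↦ 1 + max_b P b ⬝ w`. -/
structure IsUnitCost (G : StructuredGame S (fun _ => Unit) B) : Prop where
  γ_eq : ∀ i a b, G.γ i a b = 1
  L_eq : G.L = ContinuousLinearMap.id ℝ (S → ℝ)
  G_eq : ∀ i a b w, G.G i a b w = 1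

variable (G : StructuredGame S (fun _ => Unit) B)

/-- The value `1 + P b ⬝ w` of the action `b` in the state `i`. -/
def actionValue (w : S → ℝ) (i : S) (b : B i ()) : ℝ := 1 + ∑ j, G.P i () b j * w j

/-- The number `y` is, up to `η`, the maximal value of an action in the state `i`. -/
def IsApxValue (w : S → ℝ) (η : ℝ) (i : S) (y : ℝ) : Prop :=
  (∀ b, G.actionValue w i b - η ≤ y) ∧ ∃ b, y ≤ G.actionValue w i b + η

theorem card_triples [∀ i a, Fintype (B i a)] : Fintype.card (Triples S (fun _ => Unit) B) =
    ∑ i, Fintype.card (B i ()) := by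
  rw [Fintype.card_sigma]
  exact Finset.sum_congr rfl fun i _ => by rw [Fintype.card_sigma, Fintype.sum_unique]

variable {G} [∀ i a, Fintype (B i a)] [∀ i a, Nonempty (B i a)]

/-- By linearity P w = P w₀ + P (w - w₀); the offset and the fresh estimate each contribute ε. Only
the distance `D` from w₀ enters the sample size, and δ is split evenly over the triples. -/
theorem spec_sApxVal [Nonempty S] (hG : G.IsUnitCost) {w w₀ : S → ℝ}
    {x : Triples S (fun _ => Unit) B → ℝ} {ε δ D : ℝ} (hε : 0 < ε) (hδ : 0 < δ) (hδ' : δ ≤ 1)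
    (hx : ∀ e, |x e - ∑ j, G.P e.1 e.2.1 e.2.2 j * w₀ j| ≤ ε) (hD : 0 ≤ D)
    (hw : ∀ i, |w i - w₀ i| ≤ D) :
    (G.sApxVal w w₀ x ε δ).Spec
      (Fintype.card (Triples S (fun _ => Unit) B) * (8 * D ^ 2 / ε ^ 2 *
        Real.log (2 / (δ / Fintype.card (Triples S (fun _ => Unit) B))) + 34)) δ
      fun out => ∀ i, G.IsApxValue w (2 * ε) i (out.1 i) := by
  classical
  set N : ℝ := ((Fintype.card (Triples S (fun _ => Unit) B) : ℕ) : ℝ) with hN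
  set n : ℝ := ((Fintype.card S : ℕ) : ℝ) with hn
  have hNsum : N = ∑ i, (Fintype.card (B i ()) : ℝ) := by
    rw [hN, card_triples]
    push_cast
    rfl
  have hnN : n ≤ N := by
    rw [hNsum, hn, ← Finset.card_univ, Finset.card_eq_sum_ones]
    push_cast
    exact Finset.sum_le_sum fun i _ => by exact_mod_cast Fintype.card_pos
  have hn1 : 1 ≤ n := by
    rw [hn]
    exact_mod_cast Fintype.card_pos
  have hδN : 0 < δ / N := div_pos hδ (by linarith)
  have hδN' : δ / N ≤ 1 := (div_le_self hδ.le (by linarith)).trans hδ'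
  set X := 8 * D ^ 2 / ε ^ 2 * Real.log (2 / (δ / N)) + 13 with hX
  have hlog : 0 ≤ Real.log (2 / (δ / N)) := Real.log_nonneg (by rw [le_div_iff₀ hδN]; linarith)
  have hnorm : ‖G.L‖ = 1 := by rw [hG.L_eq, ContinuousLinearMap.norm_id]
  -- `T` and `η` mirror the program instruction by instruction; 1 ≤ n ≤ N then absorbs all lower
  -- terms into the constant 34.
  refine RandComp.Spec.mono (T := 3 * n + (3 * n + (1 + (n + (1 + ∑ i, (((Fintype.card Unit *
    ((Fintype.card (B i ()) * (X + (1 + (1 + (1 + (1 + 1)))) + 1) + (1 + (1 + 0))) + 1)) +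
    (1 + (1 + 0))) + 1))))))
    (η := 0 + (0 + ∑ i, ((Fintype.card Unit * (Fintype.card (B i ()) * (δ / N + 0) + 0)) + 0)))
    ?_ ?_ ?_ fun _ h => h
  · unfold sApxVal
    have hη0 : 0 ≤ ∑ i, ((Fintype.card Unit * (Fintype.card (B i ()) * (δ / N + 0) + 0)) + 0) := by
      positivity
    refine RandComp.Spec.bind (spec_vecSub w w₀) ?_ le_rfl (by positivity)
    rintro d rfl
    refine RandComp.Spec.bind (spec_supNorm _) ?_ le_rfl (by positivity)
    rintro M ⟨hM0, hM, hMD⟩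
    specialize hMD D hD hw
    rw [hnorm, one_mul, hG.L_eq, ContinuousLinearMap.id_apply]
    refine RandComp.Spec.bind_op hη0 (RandComp.Spec.bind_charge hη0 (RandComp.Spec.bind_op hη0 ?_))
    refine (RandComp.Spec.loop_elems (fun l (out : Output S (fun _ => Unit) B) =>
      ∀ i ∉ l, G.IsApxValue w (2 * ε) i (out.1 i)) (fun i => by positivity) ?_ _
      fun i hi => absurd (RandComp.mem_elems i) hi).mono le_rfl le_rfl
      fun out h i => h i (by simp)
    intro i l out hout
    refine RandComp.Spec.bind (Q := fun r => ∃ va ∈ r.1, G.IsApxValue w (2 * ε) i va.1)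
      ?_ ?_ (by positivity) le_rfl
    · refine (RandComp.Spec.loop_elems_const (fun l (acc : Option (ℝ × Unit) × _) =>
        (∀ r ∈ acc.1, G.IsApxValue w (2 * ε) i r.1) ∧ (() ∉ l → acc.1 ≠ none)) (by positivity)
        ?_ _ ⟨by simp, fun h => absurd (RandComp.mem_elems _) h⟩).mono le_rfl le_rfl ?_
      · intro a l acc hacc
        refine RandComp.Spec.bind (Q := fun best => ∃ vb ∈ best, G.IsApxValue w (2 * ε) i vb.1)
          ?_ ?_ (by positivity) le_rfl
        · refine (RandComp.Spec.loop_elems_const (fun l (best : Option (ℝ × B i a)) =>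
            (∀ b ∉ l, ∃ r ∈ best, G.actionValue w i b - 2 * ε ≤ r.1) ∧
            ∀ r ∈ best, ∃ b, r.1 ≤ G.actionValue w i b + 2 * ε) (by positivity)
            ?_ _ ⟨fun b hb => absurd (RandComp.mem_elems b) hb, by simp⟩).mono le_rfl le_rfl ?_
          · intro b l best hbest
            have hapx := (G.spec_apxTransC (fun i => w i - w₀ i) hM hM0 i a b hε hδN hδN').mono
              (T' := X) (by rw [hX]; gcongr) le_rfl fun _ h => h
            refine RandComp.Spec.bind hapx (fun y hy => ?_) hδN.le le_rfl
            iterate 4 refine RandComp.Spec.bind_op le_rfl ?_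
            refine RandComp.Spec.op (RandComp.Spec.keepMax ?_ hbest)
            have h1 := hx ⟨i, a, b⟩
            have h2 : ∑ j, G.P i a b j * (w j - w₀ j) =
                ∑ j, G.P i a b j * w j - ∑ j, G.P i a b j * w₀ j := by
              rw [← Finset.sum_sub_distrib]
              exact Finset.sum_congr rfl fun j _ => by ring
            rw [h2] at hy
            rw [hG.γ_eq, hG.G_eq, actionValue]
            rw [abs_le] at *
            constructor <;> linarith [h1.1, h1.2, hy.1, hy.2]
          · rintro best ⟨h1, h2⟩
            -- MAX has at least one action, so the accumulator is filled and the default value 0 of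
            -- `getD` is never used.
            obtain ⟨r, hr, -⟩ := h1 (Classical.arbitrary _) (by simp)
            refine ⟨r, hr, fun b => ?_, h2 r hr⟩
            obtain ⟨r', hr', h⟩ := h1 b (by simp)
            cases Option.mem_unique hr hr'
            exact h
        · rintro best ⟨vb, hvb, hgood⟩
          obtain rfl : best = some vb := hvb
          refine RandComp.Spec.bind_op le_rfl (RandComp.Spec.bind_op le_rfl
            (RandComp.Spec.pure ?_))
          have := keepMin_property (b := a) hgood hacc.1
          exact ⟨this.2, fun _ => this.1⟩
      · rintro acc ⟨h1, h2⟩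
        obtain ⟨r, hr⟩ := Option.ne_none_iff_exists'.1 (h2 (by simp))
        exact ⟨r, hr, h1 r hr⟩
    · rintro ⟨best, τ⟩ ⟨va, hva, hgood⟩
      obtain rfl : best = some va := hva
      refine RandComp.Spec.bind_op le_rfl (RandComp.Spec.bind_op le_rfl
            (RandComp.Spec.pure ?_))
      intro j hj
      by_cases hji : j = i
      · subst hji
        simpa using hgood
      · simp only [Function.update_of_ne hji]
        exact hout j (by simp [hji, hj])
  · have : ∑ i, (((Fintype.card Unit *
      ((Fintype.card (B i ()) * (X + (1 + (1 + (1 + (1 + 1)))) + 1) + (1 + (1 + 0))) + 1)) +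
      (1 + (1 + 0))) + 1) = N * (X + 6) + 6 * n := by
      simp only [Fintype.card_unit, Finset.sum_add_distrib, Nat.cast_one, one_mul, add_zero,
        ← Finset.sum_mul, ← hNsum, Finset.sum_const, Finset.card_univ, nsmul_eq_mul, ← hn]
      ring
    have h2 : N * (8 * D ^ 2 / ε ^ 2 * Real.log (2 / (δ / N)) + 34) = N * (X + 21) := by
      rw [hX]
      ring
    rw [this, h2]
    linarith
  · simp only [Fintype.card_unit, Nat.cast_one, one_mul, add_zero, ← Finset.sum_mul, ← hNsum,
      zero_add]
    rw [mul_div_cancel₀ _ (by linarith)]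

end StructuredGame

/-! ### The weighted contraction and one phase of the algorithm. -/

namespace StructuredGame

variable {S : Type} [Fintype S] {B : S → Unit → Type} {G : StructuredGame S (fun _ => Unit) B}

/-- The operator of the game contracts at rate `1 - 1 / H` in the sup-norm weighted by its fixed
point `t`, if `1 ≤ t ≤ H`. -/
theorem IsApxValue.abs_sub_le {t w : S → ℝ} {H r η y : ℝ} {i : S}
    (ht : G.IsApxValue t 0 i (t i)) (ht1 : ∀ i, 1 ≤ t i) (htH : ∀ i, t i ≤ H) (hr : 0 ≤ r)
    (hη : 0 ≤ η) (hw : ∀ i, |w i - t i| ≤ r * t i) (hy : G.IsApxValue w η i y) :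
    |y - t i| ≤ ((1 - 1 / H) * r + η) * t i := by
  have hdiff : ∀ b, |∑ j, G.P i () b j * w j - ∑ j, G.P i () b j * t j| ≤
      r * ∑ j, G.P i () b j * t j := by
    intro b
    rw [← Finset.sum_sub_distrib, Finset.mul_sum]
    refine (Finset.abs_sum_le_sum_abs _ _).trans (Finset.sum_le_sum fun j _ => ?_)
    rw [← mul_sub, abs_mul, abs_of_nonneg (G.P_nonneg _ _ _ _), mul_left_comm]
    exact mul_le_mul_of_nonneg_left (hw j) (G.P_nonneg _ _ _ _)
  have hti := ht1 i
  have hH : 0 < H := by linarith [htH i]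
  -- This is where the rate arises: t i / H ≤ 1 turns t i - 1 into at most (1 - 1/H) t i, while 1 ≤
  -- t i makes η weighted.
  have h1 : r * (t i - 1) + η ≤ ((1 - 1 / H) * r + η) * t i := by
    have h2 : t i / H ≤ 1 := (div_le_one hH).2 (htH i)
    have h3 : ((1 - 1 / H) * r + η) * t i = r * (t i - t i / H) + η * t i := by ring
    rw [h3]
    nlinarith
  obtain ⟨hlow, b₁, hb₁⟩ := hy
  obtain ⟨hup, b₀, hb₀⟩ := ht
  have e0 := hlow b₀
  have e1 := hup b₁
  have e2 := hup b₀
  have d0 := abs_le.1 (hdiff b₀)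
  have d1 := abs_le.1 (hdiff b₁)
  simp only [actionValue] at *
  -- The lower bound tests the action `b₀` optimal for t, the upper bound the action `b₁` nearly
  -- optimal for w.
  refine le_trans (abs_le.2 ⟨?_, ?_⟩) h1
  · have : r * ∑ j, G.P i () b₀ j * t j ≤ r * (t i - 1) :=
      mul_le_mul_of_nonneg_left (by linarith) hr
    linarith [d0.1]
  · have : r * ∑ j, G.P i () b₁ j * t j ≤ r * (t i - 1) :=
      mul_le_mul_of_nonneg_left (by linarith) hr
    linarith [d1.2]

variable [∀ i a, Fintype (B i a)] [∀ i a, Nonempty (B i a)]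

/-- The weighted error is halved. The sample counts come from |w₀| ≤ 2H for the offsets and |w - w₀|
≤ 4RH for the iterations, both with accuracy R/(4H), so R cancels in the second. Offsets and
iterations each receive half of δ. -/
theorem spec_sSampledRandVI [Nonempty S] (hG : G.IsUnitCost) {t w₀ : S → ℝ} {H R δ : ℝ} {J : ℕ}
    (ht : ∀ i, G.IsApxValue t 0 i (t i)) (ht1 : ∀ i, 1 ≤ t i) (htH : ∀ i, t i ≤ H)
    (hR : 0 < R) (hR' : R ≤ 1 / 2) (hδ : 0 < δ) (hδ' : δ ≤ 1)
    (hw₀ : ∀ i, |w₀ i - t i| ≤ 2 * R * t i) (hJ : 1 ≤ J) (hJ' : (1 - 1 / H) ^ J ≤ 1 / 4) :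
    (G.sSampledRandVI w₀ J (1 / (4 * H) * R) δ).Spec
      (Fintype.card (Triples S (fun _ => Unit) B) * (512 * H ^ 4 / R ^ 2 *
        Real.log (4 * J * Fintype.card (Triples S (fun _ => Unit) B) / δ) + 23) +
       J * (Fintype.card (Triples S (fun _ => Unit) B) * (2048 * H ^ 4 *
        Real.log (4 * J * Fintype.card (Triples S (fun _ => Unit) B) / δ) + 35))) δ
      fun out => ∀ i, |out.1 i - t i| ≤ R * t i := by
  obtain ⟨i₀⟩ := ‹Nonempty S›
  have hH1 : 1 ≤ H := (ht1 i₀).trans (htH i₀)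
  have hH : 0 < H := by linarith
  set N : ℝ := ((Fintype.card (Triples S (fun _ => Unit) B) : ℕ) : ℝ) with hN
  set n : ℝ := ((Fintype.card S : ℕ) : ℝ) with hn
  have hn1 : 1 ≤ n := by
    rw [hn]
    exact_mod_cast Fintype.card_pos
  have hnN : n ≤ N := by
    rw [hN, hn, card_triples, ← Finset.card_univ, Finset.card_eq_sum_ones]
    exact_mod_cast Finset.sum_le_sum fun i _ => Fintype.card_pos
  have hJ1 : (1 : ℝ) ≤ J := by exact_mod_cast hJ
  have hN0 : 0 < N := by linarith
  set ℓ := Real.log (4 * J * N / δ) with hℓ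
  set ε := 1 / (4 * H) * R with hεdef
  have hε : 0 < ε := by positivity
  have hlam : 0 ≤ 1 - 1 / H := by
    rw [sub_nonneg, div_le_one hH]
    exact hH1
  have hℓ₂ : Real.log (2 / (δ / 2 / J / N)) = ℓ := by
    rw [hℓ]
    congr 1
    field_simp
    norm_num
  have hℓ₁ : Real.log (2 / (δ / 2 / N)) ≤ ℓ := by
    refine Real.log_le_log (by positivity) ?_
    have : 2 / (δ / 2 / N) = 4 * 1 * N / δ := by
      field_simp
      norm_num
    rw [this]
    gcongr
  have hℓ0 : 0 ≤ Real.log (2 / (δ / 2 / N)) := by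
    refine Real.log_nonneg ?_
    rw [le_div_iff₀ (by positivity), one_mul, div_div, div_le_iff₀ (by positivity)]
    nlinarith
  have hnorm : ‖G.L‖ = 1 := by rw [hG.L_eq, ContinuousLinearMap.norm_id]
  have hw₀H : ∀ i, |w₀ i| ≤ 2 * H := by
    intro i
    have h1 := abs_le.1 (hw₀ i)
    have h2 : 2 * R * t i ≤ 1 * t i :=
      mul_le_mul_of_nonneg_right (by linarith) (by linarith [ht1 i])
    rw [abs_le]
    constructor <;> linarith [htH i, ht1 i, h1.1, h1.2]
  set X := 512 * H ^ 4 / R ^ 2 * ℓ + 13 with hX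
  set Y := 2048 * H ^ 4 * ℓ + 34 with hY
  refine RandComp.Spec.mono (T := 3 * n + (1 + (n + (1 + (1 + (1 + (N * (X + 1 + 1) +
    J * (N * Y + 1)))))))) (η := 0 + (N * (δ / 2 / N + 0) + J * (δ / 2 / J))) ?_ ?_ ?_ fun _ h => h
  · unfold sSampledRandVI
    have hη0 : 0 ≤ N * (δ / 2 / N + 0) + J * (δ / 2 / J) := by positivity
    have hδN : 0 < δ / 2 / N := by positivity
    have hδJ : 0 < δ / 2 / J := by positivity
    refine RandComp.Spec.bind (spec_supNorm _) ?_ le_rfl hη0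
    rintro M ⟨hM0, hM, hMD⟩
    specialize hMD (2 * H) (by linarith) hw₀H
    rw [hnorm, one_mul, hG.L_eq, ContinuousLinearMap.id_apply]
    refine RandComp.Spec.bind_op hη0 (RandComp.Spec.bind_charge hη0 (RandComp.Spec.bind_op hη0
      (RandComp.Spec.bind_op hη0 (RandComp.Spec.bind_op hη0 ?_))))
    refine RandComp.Spec.bind (Q := fun x =>
      ∀ e, |x e - ∑ j, G.P e.1 e.2.1 e.2.2 j * w₀ j| ≤ ε) ?_ ?_ (by positivity) (by positivity)
    · have hoff : ∀ [DecidableEq (Triples S (fun _ => Unit) B)]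
          (e : Triples S (fun _ => Unit) B) (x : Triples S (fun _ => Unit) B → ℝ),
          (G.apxTransC w₀ M e.1 e.2.1 e.2.2 ε (δ / 2 / N) >>= fun y =>
            RandComp.op (Function.update x e y)).Spec (X + 1) (δ / 2 / N + 0)
          fun x' => |x' e - ∑ j, G.P e.1 e.2.1 e.2.2 j * w₀ j| ≤ ε ∧ ∀ j, j ≠ e → x' j = x j := by
        intro _ e x
        have hapx := (G.spec_apxTransC w₀ hM hM0 e.1 e.2.1 e.2.2 hε hδN
          ((div_le_self (by linarith) (by linarith)).trans (by linarith))).mono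
          (T' := X) ?_ le_rfl fun _ h => h
        · refine RandComp.Spec.bind hapx (fun y hy => RandComp.Spec.op ⟨?_, ?_⟩) hδN.le le_rfl
          · rwa [Function.update_self]
          · exact fun j hj => Function.update_of_ne hj _ _
        · have h1 : 8 * M ^ 2 / ε ^ 2 ≤ 512 * H ^ 4 / R ^ 2 := by
            calc 8 * M ^ 2 / ε ^ 2 ≤ 8 * (2 * H) ^ 2 / ε ^ 2 := by gcongr
              _ = _ := by
                rw [hεdef]
                field_simp
                norm_num
          rw [hX]
          gcongr
      have h1 := fun (dec : DecidableEq (Triples S (fun _ => Unit) B)) =>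
        RandComp.Spec.loop_update
        (fun (e : Triples S (fun _ => Unit) B) y => |y - ∑ j, G.P e.1 e.2.1 e.2.2 j * w₀ j| ≤ ε)
        (add_nonneg hδN.le le_rfl) (fun e x => @hoff dec e x) (fun _ => 0)
      exact h1 _
    · intro x hx
      -- The excess r - R/2 over the fixed point shrinks by 1 - 1/H per round from 3R/2; after J
      -- rounds r ≤ R/2 + 3R/8 < R. The bound r ≤ 2R keeps the iterates near w₀.
      have hloop := RandComp.Spec.loop_const
        (fun (l : List ℕ) (out : Output S (fun _ => Unit) B) => ∃ r, R / 2 ≤ r ∧ r ≤ 2 * R ∧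
          (∀ i, |out.1 i - t i| ≤ r * t i) ∧
          (1 - 1 / H) ^ l.length * (r - R / 2) ≤ (1 - 1 / H) ^ J * (3 / 2 * R))
        (body := fun _ out => G.sApxVal out.1 w₀ x ε (δ / 2 / J)) (T := N * Y) hδJ.le ?_
        (List.range J) (w₀, fun _ => Classical.arbitrary _, fun _ _ => Classical.arbitrary _)
        ⟨2 * R, by linarith, le_rfl, hw₀, le_of_eq (by rw [List.length_range]; ring)⟩
      · rw [List.length_range] at hloop
        refine hloop.mono le_rfl le_rfl ?_
        rintro out ⟨r, -, -, hr, hle⟩ i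
        rw [List.length_nil, pow_zero, one_mul] at hle
        have h1 : (1 - 1 / H) ^ J * (3 / 2 * R) ≤ 1 / 4 * (3 / 2 * R) := by gcongr
        exact (hr i).trans (mul_le_mul_of_nonneg_right (by linarith) (by linarith [ht1 i]))
      · rintro _ l out ⟨r, hr1, hr2, hr, hle⟩
        have hd : ∀ i, |out.1 i - w₀ i| ≤ 4 * R * H := by
          intro i
          have h1 := abs_le.1 (hr i)
          have h2 := abs_le.1 (hw₀ i)
          have h3 : r * t i ≤ 2 * R * t i :=
            mul_le_mul_of_nonneg_right hr2 (by linarith [ht1 i])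
          have h4 : 2 * R * t i ≤ 2 * R * H := by
            have := htH i
            gcongr
          rw [abs_le]
          constructor <;> linarith [h1.1, h1.2, h2.1, h2.2]
        have h := spec_sApxVal hG hε hδJ
          ((div_le_self (by linarith) hJ1).trans (by linarith)) hx (by positivity) hd
        refine h.mono (le_of_eq ?_) le_rfl fun out' hout => ?_
        · rw [← hN, hℓ₂, hY, hεdef]
          congr 2
          field_simp
          ring
        · have hεR : 2 * ε = (1 - (1 - 1 / H)) * (R / 2) := by
            rw [hεdef]
            field_simp
            ring
          refine ⟨(1 - 1 / H) * r + 2 * ε, ?_, ?_, fun i =>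
            (ht i).abs_sub_le ht1 htH (by linarith) (by positivity) hr (hout i), ?_⟩
          · nlinarith
          · have : 0 ≤ 1 / H := by positivity
            nlinarith
          · refine le_trans (le_of_eq ?_) hle
            rw [hεR, List.length_cons, pow_succ]
            ring
  · have h1 : N * (512 * H ^ 4 / R ^ 2 * ℓ + 23) = N * (X + 2) + 8 * N := by rw [hX]; ring
    have h2 : J * (N * (2048 * H ^ 4 * ℓ + 35)) = J * (N * Y) + J * N := by rw [hY]; ring
    rw [h1, h2]
    have h3 : (J : ℝ) * 1 ≤ J * N := by gcongr; linarith
    linarith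
  · rw [add_zero, mul_div_cancel₀ _ (by positivity), mul_div_cancel₀ _ (by positivity)]
    linarith

end StructuredGame

/-! ### The succession of phases. -/

theorem one_sub_inv_pow_le {H : ℝ} (hH : 1 ≤ H) {J : ℕ} (hJ : Real.log 4 * H ≤ J) :
    (1 - 1 / H) ^ J ≤ 1 / 4 := by
  have hH0 : 0 < H := by linarith
  have h0 : 0 ≤ 1 - 1 / H := by
    rw [sub_nonneg, div_le_one hH0]
    exact hH
  calc (1 - 1 / H) ^ J ≤ Real.exp (-(1 / H)) ^ J := by
        gcongr
        exact Real.one_sub_le_exp_neg _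
    _ = Real.exp (-(J / H)) := by
        rw [← Real.exp_nat_mul]
        ring_nf
    _ ≤ Real.exp (-Real.log 4) := by
        rw [Real.exp_le_exp, neg_le_neg_iff, le_div_iff₀ hH0]
        exact hJ
    _ = 1 / 4 := by rw [Real.exp_neg, Real.exp_log (by norm_num), one_div]

namespace StructuredGame

variable {S : Type} [Fintype S] {B : S → Unit → Type} {G : StructuredGame S (fun _ => Unit) B}
  [∀ i a, Fintype (B i a)] [∀ i a, Nonempty (B i a)]

/-- The start w₀ = 0 has weighted error exactly 1, and each of the K phases halves the bound at
failure cost δ/K. -/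
theorem spec_sSublinearRandVI [Nonempty S] (hG : G.IsUnitCost) {t : S → ℝ} {H δ : ℝ} {J K : ℕ}
    {N : ℝ} (hN : N = Fintype.card (Triples S (fun _ => Unit) B))
    (ht : ∀ i, G.IsApxValue t 0 i (t i)) (ht1 : ∀ i, 1 ≤ t i) (htH : ∀ i, t i ≤ H) (hH : 1 ≤ H)
    (hδ : 0 < δ) (hδ' : δ ≤ 1) (hJ : J = ⌈Real.log 4 * H⌉₊) (hK : K = ⌈Real.logb 2 (4 * H)⌉₊) :
    (G.sSublinearRandVI (1 / 4) δ (1 - 1 / H) 1 1 1 (1 / (1 - (1 - 1 / H)))).Spec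
      (12 + K * (N * (32768 * H ^ 6 * Real.log (4 * J * N / (δ / K)) + 23) +
        J * (N * (2048 * H ^ 4 * Real.log (4 * J * N / (δ / K)) + 35)) + 3)) δ
      fun out => ∀ i, |out.1 i - t i| ≤ 1 / 4 := by
  have hH0 : 0 < H := by linarith
  have hlog4 : 0 < Real.log 4 := Real.log_pos (by norm_num)
  have hlogb : 0 < Real.logb 2 (4 * H) := Real.logb_pos (by norm_num) (by linarith)
  have hJpos : 1 ≤ J := by rw [hJ, Nat.one_le_ceil_iff]; positivity
  have hKpos : 1 ≤ K := by rw [hK, Nat.one_le_ceil_iff]; exact hlogb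
  have hK1 : (1 : ℝ) ≤ K := by exact_mod_cast hKpos
  have hJ1 : (1 : ℝ) ≤ J := by exact_mod_cast hJpos
  have hN1 : 1 ≤ N := by
    have : Nonempty (Triples S (fun _ => Unit) B) :=
      ⟨⟨Classical.arbitrary S, (), Classical.arbitrary _⟩⟩
    rw [hN]
    exact_mod_cast Fintype.card_pos
  have hJ' : (1 - 1 / H) ^ J ≤ 1 / 4 := one_sub_inv_pow_le hH (hJ ▸ Nat.le_ceil _)
  -- The final weighted error 1/(4H), multiplied by t ≤ H, gives 1/4. The opposite estimate `hKup`
  -- keeps R from becoming too small, which bounds the cost of the offsets.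
  have hKlow : (1 / 2 : ℝ) ^ K ≤ 1 / (4 * H) := by
    rw [one_div_pow]
    refine one_div_le_one_div_of_le (by positivity) ?_
    rw [← Real.rpow_natCast]
    calc 4 * H = 2 ^ Real.logb 2 (4 * H) :=
          (Real.rpow_logb (by norm_num) (by norm_num) (by positivity)).symm
      _ ≤ 2 ^ (K : ℝ) := Real.rpow_le_rpow_of_exponent_le (by norm_num) (hK ▸ Nat.le_ceil _)
  have hKup : 1 / (8 * H) ≤ (1 / 2 : ℝ) ^ K := by
    rw [one_div_pow]
    refine one_div_le_one_div_of_le (by positivity) ?_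
    rw [← Real.rpow_natCast]
    calc (2 : ℝ) ^ (K : ℝ) ≤ 2 ^ (Real.logb 2 (4 * H) + 1) :=
          Real.rpow_le_rpow_of_exponent_le (by norm_num)
            (hK ▸ (Nat.ceil_lt_add_one hlogb.le).le)
      _ = 8 * H := by
        rw [Real.rpow_add (by norm_num), Real.rpow_logb (by norm_num) (by norm_num) (by positivity),
          Real.rpow_one]
        ring
  have hδK : 0 < δ / K := by positivity
  have hδK' : δ / K ≤ 1 := (div_le_self hδ.le hK1).trans hδ'
  have hℓ : 0 ≤ Real.log (4 * J * N / (δ / K)) := by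
    refine Real.log_nonneg ?_
    rw [le_div_iff₀ hδK]
    nlinarith
  set ℓ := Real.log (4 * J * N / (δ / K)) with hℓdef
  set Y := N * (32768 * H ^ 6 * ℓ + 23) + J * (N * (2048 * H ^ 4 * ℓ + 35)) with hY
  refine RandComp.Spec.mono (T := 1 + (1 + (1 + (1 + (1 + (1 + (1 + (1 + (1 + (1 + (1 + (1 +
    (K * (1 + (1 + (Y + 0)) + 1) + 0))))))))))))) (η := K * (δ / K + 0) + 0) ?_ ?_ ?_ fun _ h => h
  · have hη0 : 0 ≤ K * (δ / K + 0) + 0 := by positivity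
    unfold sSublinearRandVI
    iterate 12 refine RandComp.Spec.bind_op hη0 ?_
    have e1 : 1 / (1 - (1 - 1 / H)) * 1 / (1 / 4) = 4 * H := by
      field_simp
      ring
    have e2 : Real.log 4 / (1 - (1 - 1 / H)) = Real.log 4 * H := by
      rw [sub_sub_cancel, div_div_eq_mul_div, div_one]
    have e3 : (1 - (1 - 1 / H)) / (4 * 1 * 1) = 1 / (4 * H) := by
      field_simp
      ring
    rw [e1, e2, e3, ← hJ, ← hK]
    refine RandComp.Spec.bind (Q := fun p => ∀ i, |p.2.1 i - t i| ≤ 1 / 4) ?_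
      (fun p hp => RandComp.Spec.pure hp) (by positivity) le_rfl
    -- The current radius `p.1` is tied to the number of remaining phases by a product identity,
    -- which needs no phase index.
    have hbody : ∀ (k : ℕ) (l : List ℕ) (p : ℝ × Output S (fun _ => Unit) B),
        (0 < p.1 ∧ p.1 ≤ 1 ∧ p.1 * (1 / 2) ^ (k :: l).length = (1 / 2) ^ K ∧
          ∀ i, |p.2.1 i - t i| ≤ p.1 * t i) →
        (RandComp.op (p.1 / 2) >>= fun εk => RandComp.op (1 / (4 * H) * εk) >>= fun acc =>
          G.sSampledRandVI p.2.1 J acc (δ / K) >>= fun out => pure (εk, out)).Spec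
        (1 + (1 + (Y + 0))) (δ / K + 0) fun p =>
        0 < p.1 ∧ p.1 ≤ 1 ∧ p.1 * (1 / 2) ^ l.length = (1 / 2) ^ K ∧
          ∀ i, |p.2.1 i - t i| ≤ p.1 * t i := by
      rintro k l ⟨R₂, out⟩ ⟨hR0, hR1, hRK, hR⟩
      simp only at hR0 hR1 hRK hR ⊢
      refine RandComp.Spec.bind_op (by positivity) (RandComp.Spec.bind_op (by positivity) ?_)
      have hRK' : R₂ / 2 * (1 / 2) ^ l.length = (1 / 2) ^ K := by
        rw [← hRK, List.length_cons, pow_succ]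
        ring
      have hRlow : 1 / (8 * H) ≤ R₂ / 2 := by
        refine hKup.trans (hRK' ▸ ?_)
        exact mul_le_of_le_one_right (by positivity) (pow_le_one₀ (by norm_num) (by norm_num))
      have h := spec_sSampledRandVI hG (w₀ := out.1) (R := R₂ / 2) (J := J) ht ht1 htH
        (by positivity) (by linarith) hδK hδK' (fun i => by
          rw [mul_div_cancel₀ _ (by norm_num)]
          exact hR i) hJpos hJ'
      rw [← hN, ← hℓdef] at h
      refine RandComp.Spec.bind (h.mono (T' := Y) ?_ le_rfl fun _ h => h)
        (fun out' hout' => RandComp.Spec.pure ⟨by simpa using hR0, ?_, hRK', hout'⟩) hδK.le le_rfl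
      · rw [hY]
        have h1 : 512 * H ^ 4 / (R₂ / 2) ^ 2 ≤ 32768 * H ^ 6 := by
          calc 512 * H ^ 4 / (R₂ / 2) ^ 2 ≤ 512 * H ^ 4 / (1 / (8 * H)) ^ 2 := by gcongr
            _ = _ := by
              field_simp
              norm_num
        gcongr
      · simp only
        linarith
    have hloop := RandComp.Spec.loop_const
      (fun (l : List ℕ) (p : ℝ × Output S (fun _ => Unit) B) =>
        0 < p.1 ∧ p.1 ≤ 1 ∧ p.1 * (1 / 2) ^ l.length = (1 / 2) ^ K ∧
          ∀ i, |p.2.1 i - t i| ≤ p.1 * t i) (add_nonneg hδK.le le_rfl) hbody (List.range K)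
      (1, (fun _ => 0, fun _ => Classical.arbitrary _, fun _ _ => Classical.arbitrary _))
      ⟨one_pos, le_rfl, by rw [List.length_range, one_mul], fun i => by
        rw [zero_sub, abs_neg, one_mul, abs_of_nonneg (by linarith [ht1 i])]⟩
    rw [List.length_range] at hloop
    refine hloop.mono le_rfl le_rfl ?_
    rintro p ⟨hp0, -, hpK, hp⟩ i
    rw [List.length_nil, pow_zero, mul_one] at hpK
    refine (hp i).trans ?_
    calc p.1 * t i ≤ 1 / (4 * H) * H := by
          have := htH i
          have := ht1 i
          gcongr
          exact hpK ▸ hKlow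
      _ = 1 / 4 := by field_simp
  · linarith
  · rw [add_zero, add_zero, mul_div_cancel₀ _ (by positivity)]

end StructuredGame

/-! ### Application to the hitting game and final estimates. -/

namespace MeanPayoffGame

variable {S : Type} [Fintype S]
  {A : S → Type} [∀ i, Fintype (A i)] [∀ i, Nonempty (A i)]
  {B : ∀ i, A i → Type} [∀ i a, Fintype (B i a)] [∀ i a, Nonempty (B i a)]

theorem hittingGame_isUnitCost {S : Type} [Fintype S] {A : S → Type} {B : ∀ i, A i → Type}
    (g : MeanPayoffGame S A B) (c : S) :
    (g.hittingGame c).IsUnitCost :=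
  ⟨fun _ _ _ => rfl, rfl, fun _ _ _ _ => rfl⟩

theorem card_triples_hittingGame {S : Type} [Fintype S] {A : S → Type} [∀ i, Fintype (A i)]
    {B : ∀ i, A i → Type} [∀ i a, Fintype (B i a)] :
    Fintype.card (Triples S (fun _ => Unit) (fun i _ => Σ a : A i, B i a)) =
      Fintype.card (Triples S A B) := by
  rw [StructuredGame.card_triples, Fintype.card_sigma]

/-- The 17N covers the two initial steps, the twelve of the main routine, and three per state for
doubling. -/
theorem spec_findPhi (g : MeanPayoffGame S A B) (c : S) {H δ : ℝ} {J K : ℕ} {N : ℝ}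
    (hN : N = Fintype.card (Triples S A B))
    (hH : ∀ i, g.maxHittingTime c i ≤ ENNReal.ofReal H)
    (hδ : 0 < δ) (hδ' : δ ≤ 1) (hJ : J = ⌈Real.log 4 * H⌉₊) (hK : K = ⌈Real.logb 2 (4 * H)⌉₊) :
    (g.findPhi c (1 - 1 / H) δ).Spec
      (17 * N + K * (N * (32768 * H ^ 6 * Real.log (4 * J * N / (δ / K)) + 23) +
        J * (N * (2048 * H ^ 4 * Real.log (4 * J * N / (δ / K)) + 35)) + 3)) δ
      fun φ => ∀ i, |φ i - 2 * (g.maxHittingTime c i).toReal| ≤ 1 / 2 := by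
  have : Nonempty S := ⟨c⟩
  have hfin : ∀ i, g.maxHittingTime c i ≠ ⊤ := fun i =>
    ne_top_of_le_ne_top ENNReal.ofReal_ne_top (hH i)
  have ht1 : ∀ i, 1 ≤ (g.maxHittingTime c i).toReal := fun i => by
    rw [← ENNReal.toReal_one]
    exact ENNReal.toReal_mono (hfin i) (g.one_le_maxHittingTime c i)
  have hH1 : 1 ≤ H := ENNReal.one_le_ofReal.1 ((g.one_le_maxHittingTime c c).trans (hH c))
  have htH : ∀ i, (g.maxHittingTime c i).toReal ≤ H := fun i =>
    ENNReal.toReal_le_of_le_ofReal (by linarith) (hH i)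
  obtain ⟨hopt, hatt⟩ := g.maxHittingTime_optimality c hfin
  have ht : ∀ i, (g.hittingGame c).IsApxValue (fun i => (g.maxHittingTime c i).toReal) 0 i
      (g.maxHittingTime c i).toReal := by
    intro i
    refine ⟨fun b => ?_, ?_⟩
    · rw [sub_zero]
      exact hopt i b.1 b.2
    · obtain ⟨a, b, hab⟩ := hatt i
      refine ⟨⟨a, b⟩, ?_⟩
      rw [add_zero]
      exact hab.le
  have hmain := StructuredGame.spec_sSublinearRandVI (g.hittingGame_isUnitCost c)
    (hN.trans (by rw [card_triples_hittingGame])) ht ht1 htH hH1 hδ hδ' hJ hK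
  have hn : (Fintype.card S : ℝ) ≤ N := by
    rw [hN]
    exact_mod_cast Fintype.card_le_of_injective (fun i => (⟨i, Classical.arbitrary _,
      Classical.arbitrary _⟩ : Triples S A B)) fun i j h => congrArg Sigma.fst h
  have hn1 : (1 : ℝ) ≤ Fintype.card S := by exact_mod_cast Fintype.card_pos
  set Y := 12 + K * (N * (32768 * H ^ 6 * Real.log (4 * J * N / (δ / K)) + 23) +
    J * (N * (2048 * H ^ 4 * Real.log (4 * J * N / (δ / K)) + 35)) + 3) with hY
  refine RandComp.Spec.mono (T := 1 + (1 + (Y + Fintype.card S * (1 + 1 + 1))))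
    (η := δ + Fintype.card S * 0) ?_ (by rw [hY]; linarith) (le_of_eq (by ring)) fun _ h => h
  have hη : 0 ≤ δ + Fintype.card S * 0 := by linarith
  unfold findPhi
  refine RandComp.Spec.bind_op hη (RandComp.Spec.bind_op hη
    (RandComp.Spec.bind hmain (fun out hout => ?_) hδ.le (by simp)))
  have hbody : ∀ [DecidableEq S] (i : S) (φ : S → ℝ), (RandComp.op (2 * out.1 i) >>= fun y =>
      RandComp.op (Function.update φ i y)).Spec (1 + 1) 0 fun φ' =>
        |φ' i - 2 * (g.maxHittingTime c i).toReal| ≤ 1 / 2 ∧ ∀ j, j ≠ i → φ' j = φ j := by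
    intro _ i φ
    refine RandComp.Spec.bind_op le_rfl (RandComp.Spec.op
      ⟨?_, fun j hj => Function.update_of_ne hj _ _⟩)
    rw [Function.update_self, ← mul_sub, abs_mul, abs_of_pos two_pos]
    linarith [hout i]
  have hloop := fun (dec : DecidableEq S) => RandComp.Spec.loop_update
    (fun i y => |y - 2 * (g.maxHittingTime c i).toReal| ≤ 1 / 2) le_rfl
    (fun i φ => @hbody dec i φ) fun _ => 0
  exact hloop _

end MeanPayoffGame

theorem RandComp.Spec.le_prob {α : Type} {m : RandComp α} {T δ : ℝ} {Q : α → Prop}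
    (h : m.Spec T δ Q) (hδ : 0 ≤ δ) :
    ENNReal.ofReal (1 - δ) ≤ m.prob {x | (x.1 : ℝ) ≤ T ∧ Q x.2} := by
  have h1 := m.prob_compl {x | (x.1 : ℝ) ≤ T ∧ Q x.2}
  have h2 : m.prob {x | (x.1 : ℝ) ≤ T ∧ Q x.2}ᶜ ≤ ENNReal.ofReal δ := h
  rw [ENNReal.ofReal_sub _ hδ, ENNReal.ofReal_one, tsub_le_iff_right, ← h1]
  gcongr

/-- The total running time is of order `F (1 + ln F) ^ 2`. -/
theorem runningTime_le {N H δ Λ F : ℝ} {J K : ℕ} (hN : 1 ≤ N) (hH : 1 ≤ H) (hδ : 0 < δ)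
    (hΛ : 1 ≤ Λ) (hΛδ : Real.log (1 / δ) ≤ Λ) (hF : F = N * H ^ 6 * Λ)
    (hJ : J = ⌈Real.log 4 * H⌉₊) (hK : K = ⌈Real.logb 2 (4 * H)⌉₊) :
    17 * N + K * (N * (32768 * H ^ 6 * Real.log (4 * J * N / (δ / K)) + 23) +
        J * (N * (2048 * H ^ 4 * Real.log (4 * J * N / (δ / K)) + 35)) + 3) ≤
      7100000 * (F * (1 + Real.log F) ^ 2) := by
  have hH0 : 0 < H := by linarith
  have hlog2 : 1 / 2 ≤ Real.log 2 := by linarith [Real.log_two_gt_d9]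
  have hlog4 : Real.log 4 = 2 * Real.log 2 := by
    rw [show (4 : ℝ) = 2 ^ 2 by norm_num, Real.log_pow]
    norm_num
  have hlogb : 0 < Real.logb 2 (4 * H) := Real.logb_pos (by norm_num) (by linarith)
  have hJpos : 0 < J := by
    rw [hJ, Nat.ceil_pos]
    exact mul_pos (by linarith) hH0
  have hKpos : 0 < K := by rwa [hK, Nat.ceil_pos]
  have hJ0 : (0 : ℝ) < J := by exact_mod_cast hJpos
  have hK0 : (0 : ℝ) < K := by exact_mod_cast hKpos
  have hlogH : 0 ≤ Real.log H := Real.log_nonneg hH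
  have hJH : (J : ℝ) ≤ 3 * H := by
    have h1 := Nat.ceil_lt_add_one (a := Real.log 4 * H) (mul_nonneg (by linarith) hH0.le)
    rw [← hJ] at h1
    have h2 : Real.log 4 * H ≤ 2 * H :=
      mul_le_mul_of_nonneg_right (by linarith [Real.log_two_lt_d9]) hH0.le
    linarith
  have hKlog : (K : ℝ) ≤ 3 + 2 * Real.log H := by
    have h1 := Nat.ceil_lt_add_one hlogb.le
    rw [← hK] at h1
    have h2 : Real.logb 2 (4 * H) = 2 + Real.log H / Real.log 2 := by
      rw [Real.logb, Real.log_mul (by norm_num) hH0.ne', hlog4, add_div,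
        mul_div_cancel_right₀ _ (by linarith)]
    have h3 : Real.log H / Real.log 2 ≤ 2 * Real.log H := by
      rw [div_le_iff₀ (by linarith)]
      nlinarith
    linarith
  have hKH : (K : ℝ) ≤ 5 * H := by
    have := Real.log_le_sub_one_of_pos hH0
    linarith
  have hpow : ∀ k, k ≤ 6 → H ^ k ≤ H ^ 6 := fun k hk => pow_le_pow_right₀ hH hk
  have hFN : ∀ k, k ≤ 6 → N * H ^ k ≤ F := by
    intro k hk
    rw [hF]
    calc N * H ^ k ≤ N * H ^ 6 := by gcongr
      _ ≤ N * H ^ 6 * Λ := le_mul_of_one_le_right (by positivity) hΛ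
  have hNF : N ≤ F := by simpa using hFN 0 (by norm_num)
  have hF1 : 1 ≤ F := hN.trans hNF
  have hHF : H ≤ F := by
    have := hFN 1 (by norm_num)
    nlinarith
  have hlogF : 0 ≤ Real.log F := Real.log_nonneg hF1
  have hlogHF : Real.log H ≤ Real.log F := Real.log_le_log hH0 hHF
  set L := 1 + Real.log F with hL
  have hL1 : 1 ≤ L := by linarith
  have hKL : (K : ℝ) ≤ 3 * L := by linarith
  set ℓ := Real.log (4 * J * N / (δ / K)) with hℓdef
  -- The bounds J ≤ 3H and K ≤ 5H put the argument of the logarithm below 60 F / δ; then ln 60 ≤ 59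
  -- suffices.
  have hℓ : ℓ ≤ 60 * (L * Λ) := by
    have h1 : 4 * J * N / (δ / K) ≤ 60 * F * (1 / δ) := by
      calc 4 * J * N / (δ / K) = 4 * J * N * K * (1 / δ) := by field_simp
        _ ≤ 4 * (3 * H) * N * (5 * H) * (1 / δ) := by gcongr
        _ = 60 * (N * H ^ 2) * (1 / δ) := by ring
        _ ≤ 60 * F * (1 / δ) := by
          gcongr
          exact hFN 2 (by norm_num)
    have h2 : ℓ ≤ Real.log 60 + Real.log F + Real.log (1 / δ) := by
      rw [← Real.log_mul (by norm_num) (by linarith),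
        ← Real.log_mul (by positivity) (by positivity)]
      exact Real.log_le_log (by positivity) h1
    have h3 := Real.log_le_sub_one_of_pos (x := 60) (by norm_num)
    have h4 : L ≤ L * Λ := le_mul_of_one_le_right (by linarith) hΛ
    have h5 : Λ ≤ L * Λ := le_mul_of_one_le_left (by linarith) hL1
    linarith
  have hFL : F ≤ F * L := le_mul_of_one_le_right (by linarith) hL1
  have hs1 : N * (32768 * H ^ 6 * ℓ + 23) ≤ 1966103 * (F * L) := by
    calc N * (32768 * H ^ 6 * ℓ + 23) ≤ N * (32768 * H ^ 6 * (60 * (L * Λ)) + 23) := by gcongr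
      _ = 1966080 * (F * L) + 23 * N := by rw [hF]; ring
      _ ≤ _ := by linarith
  have hs2 : J * (N * (2048 * H ^ 4 * ℓ + 35)) ≤ 368745 * (F * L) := by
    have h0 : 0 ≤ L * Λ := mul_nonneg (by linarith) (by linarith)
    calc J * (N * (2048 * H ^ 4 * ℓ + 35)) ≤ J * (N * (2048 * H ^ 4 * (60 * (L * Λ)) + 35)) := by
          gcongr
      _ ≤ 3 * H * (N * (2048 * H ^ 4 * (60 * (L * Λ)) + 35)) := by gcongr
      _ = 368640 * (N * H ^ 5 * Λ * L) + 105 * (N * H ^ 1) := by ring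
      _ ≤ 368640 * (N * H ^ 6 * Λ * L) + 105 * F := by
          have h1 := hpow 5 (by norm_num)
          have h2 := hFN 1 (by norm_num)
          gcongr
      _ ≤ _ := by rw [← hF]; linarith
  have hFL0 : 0 ≤ F * L := by positivity
  calc _ ≤ 17 * F + K * (1966103 * (F * L) + 368745 * (F * L) + 3 * (F * L)) := by
        gcongr
        linarith
    _ ≤ 17 * F + 3 * L * (1966103 * (F * L) + 368745 * (F * L) + 3 * (F * L)) := by gcongr
    _ = 17 * F + 7004553 * (F * L ^ 2) := by ring
    _ ≤ _ := by
        have h1 : F ≤ F * L ^ 2 := le_mul_of_one_le_right (by linarith) (one_le_pow₀ hL1)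
        linarith

theorem mainTheorem8 :
    ∃ (C : ℝ) (k : ℕ),
      ∀ (S : Type) [Fintype S]
        (A : S → Type) [∀ i, Fintype (A i)] [∀ i, Nonempty (A i)]
        (B : ∀ i, A i → Type) [∀ i a, Fintype (B i a)] [∀ i a, Nonempty (B i a)]
        (g : MeanPayoffGame S A B) (c : S)
        (H : ℝ) (_ : ∀ i, g.maxHittingTime c i ≤ ENNReal.ofReal H)
        (lam : ℝ) (_ : lam = 1 - 1 / H)
        (δ : ℝ) (_ : 0 < δ) (_ : δ < 1)
        (F : ℝ) (_ : F = (Fintype.card (Triples S A B) : ℝ) / (1 - lam) ^ 6 *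
          max 1 (Real.log (1 / δ))),
        ENNReal.ofReal (1 - δ) ≤
          (g.findPhi c lam δ).prob
            {run | -- the number of steps
              (run.1 : ℝ) ≤ C * (F * (1 + Real.log F) ^ k) ∧
              -- the vector that is found
              (∀ i, 0 ≤ run.2 i) ∧
              (∀ i a b, 1 + ∑ j, g.deflatedP c i a b j * run.2 j ≤ run.2 i) ∧
              (∀ i, |run.2 i - 2 * (g.maxHittingTime c i).toReal| ≤ 1 / 2) ∧
              1 / (1 - (1 - 1 / ‖run.2‖)) ≤ 2 / (1 - lam) + 1 / 2} := by
  refine ⟨7100000, 2, ?_⟩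
  intro S _ A _ _ B _ _ g c H hH lam hlam δ hδ hδ' F hF
  subst hlam
  have hfin : ∀ i, g.maxHittingTime c i ≠ ⊤ := fun i =>
    ne_top_of_le_ne_top ENNReal.ofReal_ne_top (hH i)
  have ht1 : ∀ i, 1 ≤ (g.maxHittingTime c i).toReal := fun i => by
    rw [← ENNReal.toReal_one]
    exact ENNReal.toReal_mono (hfin i) (g.one_le_maxHittingTime c i)
  have hH1 : 1 ≤ H := ENNReal.one_le_ofReal.1 ((g.one_le_maxHittingTime c c).trans (hH c))
  have htH : ∀ i, (g.maxHittingTime c i).toReal ≤ H := fun i =>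
    ENNReal.toReal_le_of_le_ofReal (by linarith) (hH i)
  obtain ⟨hopt, -⟩ := g.maxHittingTime_optimality c hfin
  have : Nonempty (Triples S A B) := ⟨⟨c, Classical.arbitrary _, Classical.arbitrary _⟩⟩
  have hN : (1 : ℝ) ≤ Fintype.card (Triples S A B) := by exact_mod_cast Fintype.card_pos
  have hF' : F = Fintype.card (Triples S A B) * H ^ 6 * max 1 (Real.log (1 / δ)) := by
    rw [hF, sub_sub_cancel, one_div_pow, div_div_eq_mul_div, div_one]
  refine ((g.spec_findPhi c rfl hH hδ hδ'.le rfl rfl).le_prob hδ.le).trans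
    (RandComp.prob_mono _ ?_)
  rintro ⟨T, φ⟩ ⟨hT, hφ⟩
  simp only at hT hφ
  have hlow : ∀ i, 2 * (g.maxHittingTime c i).toReal - 1 / 2 ≤ φ i := fun i => by
    linarith [(abs_le.1 (hφ i)).1]
  have hup : ∀ i, φ i ≤ 2 * (g.maxHittingTime c i).toReal + 1 / 2 := fun i => by
    linarith [(abs_le.1 (hφ i)).2]
  have hpos : ∀ i, 0 ≤ φ i := fun i => by linarith [hlow i, ht1 i]
  refine ⟨hT.trans (runningTime_le hN hH1 hδ (le_max_left _ _) (le_max_right _ _) hF' rfl rfl),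
    hpos, fun i a b => ?_, hφ, ?_⟩
  -- With φ ≤ 2t + 1/2 and row sums at most 1, one gets 1 + P φ ≤ 1 + 2(t - 1) + 1/2 = 2t - 1/2 ≤ φ.
  · have h1 : ∑ j, g.deflatedP c i a b j * φ j ≤
        2 * ∑ j, g.deflatedP c i a b j * (g.maxHittingTime c j).toReal +
          1 / 2 * ∑ j, g.deflatedP c i a b j := by
      rw [Finset.mul_sum, Finset.mul_sum, ← Finset.sum_add_distrib]
      refine Finset.sum_le_sum fun j _ => ?_
      have := mul_le_mul_of_nonneg_left (hup j) (g.deflatedP_nonneg c i a b j)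
      linarith
    have h2 := g.sum_deflatedP_le c i a b
    have h3 := hopt i a b
    simp only
    linarith [hlow i]
  -- The left side is the norm of φ, and H = 1/(1 - λ).
  · simp only
    rw [sub_sub_cancel, sub_sub_cancel, one_div_one_div, div_div_eq_mul_div, div_one,
      pi_norm_le_iff_of_nonneg (by linarith)]
    intro i
    rw [Real.norm_of_nonneg (hpos i)]
    linarith [hup i, htH i]
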